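/- **Convolution on disks using the derivative boundary condition.** *Notation.* Let $a>0$, $b:=a/2$, and $\mathbb{B}_r:=\{\mathbf{x}\in\mathbb{R}^2:\|\mathbf{x}\|_2\le r\}$; write $f(r,\theta)$ for $f(r\cos\theta,r\sin\theta)$. For $m\in\mathbb{Z}$ let $J_m$ be the Bessel function of the first kind of order $m$, and let $z_{m1}<z_{m2}<\cdots$ be the positive zeros of $J_m'$ in increasing order, except that for $m=0$ the zero $x=0$ is included as $z_{01}=0$. Put $\rho_{nm}:=a^{-1}z_{mn}$, $$N_n^{(m)}(a):=\frac{a^2}{2}\Big(1-\frac{m^2}{z_{mn}^2}\Big)J_m(z_{mn})^2,\qquad \Psi_{nm}^a(r,\theta):=\frac{J_m(\rho_{nm}r)}{\sqrt{N_n^{(m)}(a)}}\,\frac{e^{\mathrm{i}m\theta}}{\sqrt{2\pi}},$$ with $m^2/z_{mn}^2:=0$ for $m=0$ (so $N_1^{(0)}(a)=a^2/2$), and $$C_{n,m}^a[f]:=\int_0^a\int_0^{2\pi}f(r,\theta)\,\overline{\Psi_{nm}^a(r,\theta)}\,r\,d\theta\,dr .$$ For $f_1,f_2:\mathbb{R}^2\to\mathbb{C}$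 let $$(f_1\circledast f_2)(\mathbf{x}):=\int_{\mathbb{R}^2}(\mathbf{1}_{\mathbb{B}_b}f_1)(\mathbf{y})\,(\mathbf{1}_{\mathbb{B}_b}f_2)(\mathbf{x}-\mathbf{y})\,d\mathbf{y}$$ be the zero-padded convolution, and for $\omega=(\omega_1,\omega_2)\in\mathbb{R}^2$ let $$\widehat{f_j}[\omega;b]:=\int_0^b\int_0^{2\pi}f_j(r,\theta)\,e^{-\pi\mathrm{i}r(\omega_1\cos\theta+\omega_2\sin\theta)}\,r\,d\theta\,dr .$$ For $\mathbf{k}\in\mathbb{Z}^2$ let $|\mathbf{k}|$ be its Euclidean norm and $\Phi(\mathbf{k})\in[0,2\pi)$ its polar angle ($\Phi(\mathbf 0):=0$), and put $$c_a'(\mathbf{k};n,m):=\pi\sqrt{\pi}\,\frac{\mathrm{i}^m\,\varepsilon_{n,m}\,|\mathbf{k}|\,\rho_{nm}\,J_m'(\pi|\mathbf{k}|)\,e^{-\mathrm{i}m\Phi(\mathbf{k})}}{2\,(z_{mn}^2-m^2)^{1/2}\,(z_{mn}^2-\pi^2|\mathbf{k}|^2)},\qquad \varepsilon_{n,m}:=\begin{cases}(-1)^{n-1},&m\ge0,\\(-1)^{n-1+m},&m<0.\end{cases}$$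 Here $\rho_{nm}/(z_{mn}^2-m^2)^{1/2}$ is read as $a^{-1}$ when $m=0$, and if $\pi|\mathbf{k}|=z_{mn}$ the quotient $\pi|\mathbf{k}|J_m'(\pi|\mathbf{k}|)/(z_{mn}^2-\pi^2|\mathbf{k}|^2)$ is read as its limiting value $\frac12\big(1-\frac{m^2}{z_{mn}^2}\big)J_m(z_{mn})$ (again with $m^2/z_{mn}^2:=0$ for $m=0$). **Theorem.** Let $a>0$ and $b:=a/2$. Suppose $f_1,f_2:\mathbb{R}^2\to\mathbb{C}$ are square-integrable on $\mathbb{B}_b$. Then, for all $m\in\mathbb{Z}$ and $n\in\mathbb{N}=\{1,2,3,\dots\}$, $$C_{n,m}^a[f_1\circledast f_2]=\sum_{\mathbf{k}\in\mathbb{Z}^2}c_a'(\mathbf{k};n,m)\,\widehat{f_1}[a^{-1}\mathbf{k};b]\,\widehat{f_2}[a^{-1}\mathbf{k};b],$$ where the series converges unconditionally. -/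

import Mathlib

open MeasureTheory

noncomputable section

namespace DiskConvolution

/-- The Euclidean plane. -/
abbrev Plane : Type := EuclideanSpace ℝ (Fin 2)

/-- The closed disk of radius `a` centred at the origin. -/
def disk (a : ℝ) : Set Plane := Metric.closedBall 0 a

/-- The point `r u_θ` with polar coordinates `(r, θ)`. -/
def polar (r θ : ℝ) : Plane := !₂[r * Real.cos θ, r * Real.sin θ]

/-- The Bessel function `J_m` of the first kind of integer order `m`, for real argument
(Bessel's integral; it satisfies `J_{-m} = (-1)^m J_m`). -/
def besselJ (m : ℤ) (x : ℝ) : ℝ :=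
  (2 * Real.pi)⁻¹ * ∫ t in (0 : ℝ)..(2 * Real.pi), Real.cos (m * t - x * Real.sin t)

/-- The derivative `J_m'`. -/
def besselJ' (m : ℤ) : ℝ → ℝ := deriv (besselJ m)

/-- The admissible zeros of `J_m'` for the derivative boundary condition: the positive zeros and,
if `m = 0`, also the zero `x = 0` (whose radial eigenfunction `J_0(0 · r) = 1` is not trivial). -/
def derivZeros (m : ℤ) : Set ℝ :=
  {x | besselJ' m x = 0 ∧ (0 < x ∨ (m = 0 ∧ x = 0))}

/-- The `n`-th element `z_{mn}`, `n = 1, 2, 3, …`, of `derivZeros m` in increasing order: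
`z_{m,1}` is the least element and `z_{m,n+1}` is the least element above `z_{m,n}`.
(The value `-1` at the unused index `0` lies below all zeros and only starts the recursion.) -/
def besselZero (m : ℤ) : ℕ → ℝ
  | 0 => -1
  | n + 1 => sInf {x | x ∈ derivZeros m ∧ besselZero m n < x}

/-- `ρ_{nm} = a⁻¹ z_{mn}`. -/
def rho (a : ℝ) (n : ℕ) (m : ℤ) : ℝ := a⁻¹ * besselZero m n

/-- The normalizing constant `N_n^{(m)}(a) = (a² / 2) (1 - m² / z_{mn}²) J_m(z_{mn})²`.
For `m = 0`, `n = 1`, where `z_{01} = 0`, the quotient `m² / z²` is `0` and `N_1^{(0)}(a) = a² / 2`. -/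
def normConst (a : ℝ) (n : ℕ) (m : ℤ) : ℝ :=
  a ^ 2 / 2 * (1 - (m : ℝ) ^ 2 / besselZero m n ^ 2) * besselJ m (besselZero m n) ^ 2

/-- The angular function `𝒴_m(θ) = (2π)^{-1/2} e^{i m θ}`. -/
def angular (m : ℤ) (θ : ℝ) : ℂ :=
  ((Real.sqrt (2 * Real.pi))⁻¹ : ℝ) * Complex.exp (Complex.I * m * θ)

/-- The normalized radial function `𝒥_{nm}^a(r) = N_n^{(m)}(a)^{-1/2} J_m(ρ_{nm} r)`. -/
def radial (a : ℝ) (n : ℕ) (m : ℤ) (r : ℝ) : ℝ :=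
  (Real.sqrt (normConst a n m))⁻¹ * besselJ m (rho a n m * r)

/-- The basis function `Ψ_{nm}^a(r, θ) = 𝒥_{nm}^a(r) 𝒴_m(θ)`. -/
def basisFun (a : ℝ) (n : ℕ) (m : ℤ) (r θ : ℝ) : ℂ :=
  (radial a n m r : ℂ) * angular m θ

/-- The coefficient
`C_{n,m}^a[f] = ∫_0^a ∫_0^{2π} f(r, θ) conj(Ψ_{nm}^a(r, θ)) dθ r dr`. -/
def coeff (a : ℝ) (n : ℕ) (m : ℤ) (f : Plane → ℂ) : ℂ :=
  ∫ r in (0 : ℝ)..a, ∫ θ in (0 : ℝ)..(2 * Real.pi),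
    f (polar r θ) * (starRingEnd ℂ) (basisFun a n m r θ) * (r : ℂ)

/-- The transform `f̂[ω; b] = ∫_0^b ∫_0^{2π} f(r, θ) e^{-π i r (ω₁ cos θ + ω₂ sin θ)} dθ r dr`. -/
def diskFourier (f : Plane → ℂ) (ω : Plane) (b : ℝ) : ℂ :=
  ∫ r in (0 : ℝ)..b, ∫ θ in (0 : ℝ)..(2 * Real.pi),
    f (polar r θ) *
      Complex.exp (-(Real.pi * Complex.I * r * (ω 0 * Real.cos θ + ω 1 * Real.sin θ))) * (r : ℂ)

/-- The zero-padded convolution `f₁ ⊛ f₂ = E(ξ₁) ∗ E(ξ₂)`, where `E(ξ_j)` equals `f_j` on the disk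
of radius `b` and `0` elsewhere. -/
def paddedConv (b : ℝ) (f₁ f₂ : Plane → ℂ) : Plane → ℂ := fun x =>
  ∫ y, (disk b).indicator f₁ y * (disk b).indicator f₂ (x - y)

/-- `|k| = (k₁² + k₂²)^{1/2}` for a lattice point `k`. -/
def latticeNorm (k : ℤ × ℤ) : ℝ := Real.sqrt ((k.1 : ℝ) ^ 2 + (k.2 : ℝ) ^ 2)

/-- The polar angle `Φ(k) ∈ [0, 2π)` of a lattice point `k` (and `0` for `k = 0`). -/
def latticeAngle (k : ℤ × ℤ) : ℝ :=
  toIcoMod Real.two_pi_pos 0 (Complex.arg ⟨(k.1 : ℝ), (k.2 : ℝ)⟩)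

/-- The point `a⁻¹ k` of the plane. -/
def scaledLattice (a : ℝ) (k : ℤ × ℤ) : Plane := !₂[a⁻¹ * (k.1 : ℝ), a⁻¹ * (k.2 : ℝ)]

/-- The sign `ε_{n,m}` of `J_m(z_{mn})`:
`(-1)^{n-1}` for `m ≥ 0` and `(-1)^{n-1+m}` for `m < 0`. -/
def signFactor (n : ℕ) (m : ℤ) : ℝ :=
  (-1) ^ (n - 1) * (if 0 ≤ m then 1 else (-1) ^ m)

/-- The factor `ρ_{nm} / (z_{mn}² - m²)^{1/2}`, which is `a⁻¹` for `m = 0`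
(also for `n = 1`, where `z_{01} = 0`). -/
def rhoRatio (a : ℝ) (n : ℕ) (m : ℤ) : ℝ :=
  if m = 0 then a⁻¹ else rho a n m / Real.sqrt (besselZero m n ^ 2 - (m : ℝ) ^ 2)

/-- The quotient `t J_m'(t) / (z² - t²)` with `z = z_{mn}`, continued to `t = z` by its limit
`(1 - m² / z²) J_m(z) / 2` (with `m² / z² = 0` for `m = 0`). -/
def besselQuot (n : ℕ) (m : ℤ) (t : ℝ) : ℝ :=
  if t = besselZero m n then
    (1 - (m : ℝ) ^ 2 / besselZero m n ^ 2) * besselJ m (besselZero m n) / 2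
  else t * besselJ' m t / (besselZero m n ^ 2 - t ^ 2)

/-- The coefficient
`c'_a(k; n, m) = π^{3/2} i^m ε_{n,m} |k| ρ_{nm} J_m'(π|k|) e^{-i m Φ(k)}
  / (2 (z_{mn}² - m²)^{1/2} (z_{mn}² - π²|k|²))`. -/
def cPrime (a : ℝ) (k : ℤ × ℤ) (n : ℕ) (m : ℤ) : ℂ :=
  ((Real.sqrt Real.pi / 2 * signFactor n m * rhoRatio a n m *
      besselQuot n m (Real.pi * latticeNorm k) : ℝ) : ℂ) *
    Complex.I ^ m * Complex.exp (-(Complex.I * m * latticeAngle k))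

end DiskConvolution

end

namespace DiskConvolution

open MeasureTheory Set Filter Topology
open scoped Real

/-! The convolution of two functions supported in the disk of radius `a / 2` is supported in the
disk of radius `a`, hence, up to a null set, in the square `(-a, a]²`; so is the basis function cut
off at radius `a`. Both are square-integrable, so Parseval's identity for the characters `e^{πi
k·x/a}` of that square turns the integral of `f₁ ⊛ f₂` against the conjugate of `Ψ` into an
unconditionally convergent sum over `k` of products of Fourier coefficients
(`hasSum_planeChar_parseval`). Those of the convolution factor into the two disk transforms
(`integral_paddedConv_mul_planeChar`), so only those of the basis function have to be computed.

In polar coordinates the angular integral of a plane wave against `e^{-imθ}` is Bessel's integral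
(`integral_planeWave_angular`). The remaining radial overlap of two Bessel functions is given by
Lommel's integrals, where `J_m'(z) = 0` removes a boundary term (`integral_besselJ_besselZero`).
What is left is `J_m(z) / √N`: its modulus is explicit (`abs_besselJ_besselZero`) and its sign is
`ε` (`signFactor_mul_abs_besselJ`).

The sign needs the recursive enumeration of zeros to be genuine. `J_m'` has arbitrarily large zeros
(`exists_critical_gt`), and they are isolated because `J_m''` and `J_m` have opposite signs there.
Hence the values of `J_m` alternate in sign along the zeros, starting from the positivity of `J_m`,
`m ≥ 0`, just to the right of 0. -/

/-! ### Bessel functions: recurrences, differential equation, parity in the order. -/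

lemma besselJ_integrand_cont (m : ℤ) (x : ℝ) :
    Continuous fun t : ℝ => Real.cos (m * t - x * Real.sin t) := by fun_prop

/-- The recurrence `J_m' = (J_{m-1} - J_{m+1}) / 2`. -/
theorem hasDerivAt_besselJ (m : ℤ) (x : ℝ) :
    HasDerivAt (besselJ m) ((besselJ (m - 1) x - besselJ (m + 1) x) / 2) x := by
  have h := (intervalIntegral.hasDerivAt_integral_of_dominated_loc_of_deriv_le
    (μ := volume) (a := 0) (b := 2 * π) (bound := fun _ => 1) (x₀ := x) (s := Set.univ)
    (F := fun x t => Real.cos (m * t - x * Real.sin t))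
    (F' := fun x t => Real.sin (m * t - x * Real.sin t) * Real.sin t)
    Filter.univ_mem
    (.of_forall fun y => (besselJ_integrand_cont m y).aestronglyMeasurable)
    ((besselJ_integrand_cont m x).intervalIntegrable _ _)
    (by fun_prop)
    (.of_forall fun t _ y _ => by
      rw [norm_mul, Real.norm_eq_abs, Real.norm_eq_abs]
      exact mul_le_one₀ (Real.abs_sin_le_one _) (abs_nonneg _) (Real.abs_sin_le_one _))
    (by simp)
    (.of_forall fun t _ y _ => by
      have h1 : HasDerivAt (fun x : ℝ => m * t - x * Real.sin t) (-Real.sin t) y := by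
        simpa using ((hasDerivAt_id y).mul_const (Real.sin t)).const_sub (m * t)
      simpa using h1.cos)).2.const_mul (2 * π)⁻¹
  refine HasDerivAt.congr_deriv (f := besselJ m) h ?_
  simp only [besselJ]
  rw [← mul_sub, mul_div_assoc,
    ← intervalIntegral.integral_sub ((besselJ_integrand_cont _ x).intervalIntegrable _ _)
      ((besselJ_integrand_cont _ x).intervalIntegrable _ _), ← intervalIntegral.integral_div]
  congr 1
  refine intervalIntegral.integral_congr fun t _ => ?_
  have h1 : ((m - 1 : ℤ) : ℝ) * t - x * Real.sin t = (m * t - x * Real.sin t) - t := by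
    push_cast; ring
  have h2 : ((m + 1 : ℤ) : ℝ) * t - x * Real.sin t = (m * t - x * Real.sin t) + t := by
    push_cast; ring
  simp only [h1, h2]
  rw [Real.cos_sub _ t, Real.cos_add _ t]
  ring

theorem besselJ'_eq (m : ℤ) (x : ℝ) :
    besselJ' m x = (besselJ (m - 1) x - besselJ (m + 1) x) / 2 :=
  (hasDerivAt_besselJ m x).deriv

theorem hasDerivAt_besselJ' (m : ℤ) (x : ℝ) : HasDerivAt (besselJ m) (besselJ' m x) x :=
  besselJ'_eq m x ▸ hasDerivAt_besselJ m x

/-- The recurrence `2 m J_m = x (J_{m-1} + J_{m+1})`. -/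
theorem two_mul_besselJ (m : ℤ) (x : ℝ) :
    2 * m * besselJ m x = x * (besselJ (m - 1) x + besselJ (m + 1) x) := by
  -- The recurrence says that the derivative of `sin (m t - x sin t)` integrates to zero over a
  -- period.
  have hd (t : ℝ) : HasDerivAt (fun t : ℝ => Real.sin (m * t - x * Real.sin t))
      (Real.cos (m * t - x * Real.sin t) * (m - x * Real.cos t)) t := by
    have h1 : HasDerivAt (fun t : ℝ => m * t - x * Real.sin t) (m - x * Real.cos t) t := by
      simpa using ((hasDerivAt_id t).const_mul (m : ℝ)).fun_sub ((Real.hasDerivAt_sin t).const_mul x)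
    exact h1.sin
  have h0 := intervalIntegral.integral_eq_sub_of_hasDerivAt (a := 0) (b := 2 * π)
    (fun t _ => hd t) (Continuous.intervalIntegrable (by fun_prop) _ _)
  have hs : Real.sin (m * (2 * π)) = 0 := by
    have := Real.sin_int_mul_pi (2 * m); push_cast at this; rw [← this]; ring_nf
  simp only [Real.sin_two_pi, mul_zero, sub_zero, hs, Real.sin_zero] at h0
  have hI (k : ℤ) := (besselJ_integrand_cont k x).intervalIntegrable (μ := volume) 0 (2 * π)
  suffices H : (m : ℝ) * (∫ t in (0 : ℝ)..2 * π, Real.cos (m * t - x * Real.sin t)) -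
      x / 2 * ((∫ t in (0 : ℝ)..2 * π, Real.cos ((m - 1 : ℤ) * t - x * Real.sin t)) +
        ∫ t in (0 : ℝ)..2 * π, Real.cos ((m + 1 : ℤ) * t - x * Real.sin t)) = 0 by
    simp only [besselJ]
    linear_combination 2 * (2 * π)⁻¹ * H
  refine Eq.trans ?_ h0
  rw [← intervalIntegral.integral_add (hI _) (hI _), ← intervalIntegral.integral_const_mul,
    ← intervalIntegral.integral_const_mul, ← intervalIntegral.integral_sub ((hI _).const_mul _)
      (((hI _).add (hI _)).const_mul _)]
  refine intervalIntegral.integral_congr fun t _ => ?_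
  have h1 : ((m - 1 : ℤ) : ℝ) * t - x * Real.sin t = (m * t - x * Real.sin t) - t := by
    push_cast; ring
  have h2 : ((m + 1 : ℤ) : ℝ) * t - x * Real.sin t = (m * t - x * Real.sin t) + t := by
    push_cast; ring
  simp only [h1, h2]
  rw [Real.cos_sub _ t, Real.cos_add _ t]
  ring

theorem mul_besselJ'_eq_sub (m : ℤ) (x : ℝ) :
    x * besselJ' m x = m * besselJ m x - x * besselJ (m + 1) x := by
  rw [besselJ'_eq]; linear_combination -(1 / 2) * two_mul_besselJ m x

theorem mul_besselJ'_succ (m : ℤ) (x : ℝ) :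
    x * besselJ' (m + 1) x = x * besselJ m x - (m + 1) * besselJ (m + 1) x := by
  have h := two_mul_besselJ (m + 1) x
  rw [besselJ'_eq]
  push_cast at h
  simp only [add_sub_cancel_right] at h ⊢
  linear_combination (1 / 2) * h

theorem continuous_besselJ (m : ℤ) : Continuous (besselJ m) :=
  continuous_iff_continuousAt.2 fun x => (hasDerivAt_besselJ m x).continuousAt

theorem continuous_besselJ' (m : ℤ) : Continuous (besselJ' m) := by
  have : besselJ' m = fun x => (besselJ (m - 1) x - besselJ (m + 1) x) / 2 :=
    funext (besselJ'_eq m)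
  rw [this]
  exact ((continuous_besselJ _).sub (continuous_besselJ _)).div_const _

theorem differentiable_besselJ' (m : ℤ) : Differentiable ℝ (besselJ' m) := by
  have : besselJ' m = fun x => (besselJ (m - 1) x - besselJ (m + 1) x) / 2 :=
    funext (besselJ'_eq m)
  rw [this]
  exact fun x => (((hasDerivAt_besselJ _ x).sub (hasDerivAt_besselJ _ x)).div_const 2).differentiableAt

/-- Bessel's equation `x (x J_m')' = (m² - x²) J_m`. -/
theorem hasDerivAt_mul_besselJ' (m : ℤ) {x : ℝ} (hx : x ≠ 0) :
    HasDerivAt (fun x => x * besselJ' m x) ((m ^ 2 - x ^ 2) / x * besselJ m x) x := by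
  have h : HasDerivAt (fun x => m * besselJ m x - x * besselJ (m + 1) x)
      (m * besselJ' m x - (1 * besselJ (m + 1) x + x * besselJ' (m + 1) x)) x :=
    ((hasDerivAt_besselJ' m x).const_mul _).sub
      ((hasDerivAt_id x).mul (hasDerivAt_besselJ' (m + 1) x))
  have e : (fun x => m * besselJ m x - x * besselJ (m + 1) x) = fun x => x * besselJ' m x :=
    funext fun x => (mul_besselJ'_eq_sub m x).symm
  rw [e] at h
  convert h using 1
  have h1 := mul_besselJ'_eq_sub m x
  have h2 := mul_besselJ'_succ m x
  field_simp
  linear_combination -(m : ℝ) * h1 + x * h2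

/-- Shifting `t` by `π` replaces `sin t` by `-sin t` and adds the phase `m π`, which produces
`(-1)^m`; evenness of the cosine does the rest. -/
theorem besselJ_neg_int (m : ℤ) (x : ℝ) : besselJ (-m) x = (-1) ^ m * besselJ m x := by
  have hp : Function.Periodic (fun t : ℝ => Real.cos (m * t - x * Real.sin t)) (2 * π) := by
    intro t
    simp only [Real.sin_add_two_pi]
    have := Real.cos_add_int_mul_two_pi (m * t - x * Real.sin t) m
    rw [← this]; ring_nf
  have h1 := hp.intervalIntegral_add_eq (E := ℝ) π 0
  rw [zero_add] at h1
  have h2 := intervalIntegral.integral_comp_add_right (E := ℝ) (a := 0) (b := 2 * π)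
    (fun t : ℝ => Real.cos (m * t - x * Real.sin t)) π
  rw [zero_add, add_comm (2 * π) π, h1] at h2
  simp only [besselJ]
  rw [← h2, mul_left_comm ((-1 : ℝ) ^ m), ← intervalIntegral.integral_const_mul ((-1 : ℝ) ^ m)]
  congr 1
  refine intervalIntegral.integral_congr fun t _ => ?_
  simp only [Real.sin_add_pi]
  have : (m : ℝ) * (t + π) - x * -Real.sin t = (m * t + x * Real.sin t) + m * π := by ring
  rw [this, Real.cos_add_int_mul_pi, ← mul_assoc, ← mul_zpow]
  simp only [mul_neg, mul_one, neg_neg, one_zpow, one_mul]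
  rw [← Real.cos_neg]
  congr 1
  push_cast
  ring

theorem besselJ_zero_zero : besselJ 0 0 = 1 := by
  have := Real.pi_ne_zero
  simp [besselJ]
  field_simp

theorem besselJ_zero_right {m : ℤ} (hm : m ≠ 0) : besselJ m 0 = 0 := by
  have := two_mul_besselJ m 0
  have hm' : (m : ℝ) ≠ 0 := by exact_mod_cast hm
  simpa [hm'] using this

/-! ### Positivity near 0, the energy identity and nondegenerate critical points. -/

/-- Since `(x^{m+1} J_{m+1})' = x^{m+1} J_m`, positivity passes from order `m` to `m + 1` on the
same interval; the start is `J_0(0) = 1`. -/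
theorem exists_besselJ_pos :
    ∃ δ > 0, ∀ m : ℕ, ∀ x ∈ Ioo 0 δ, 0 < besselJ m x := by
  have h0 : ∀ᶠ x in 𝓝 0, 0 < besselJ 0 x :=
    (continuous_besselJ 0).continuousAt.eventually_const_lt (by rw [besselJ_zero_zero]; norm_num)
  obtain ⟨δ, hδ, h⟩ := Metric.eventually_nhds_iff.1 h0
  refine ⟨δ, hδ, fun m => ?_⟩
  induction m with
  | zero =>
    intro x hx
    exact h (by simpa [abs_of_pos hx.1] using hx.2)
  | succ m ih =>
    have hd (x : ℝ) : HasDerivAt (fun x => x ^ (m + 1) * besselJ (m + 1) x)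
        (x ^ (m + 1) * besselJ m x) x := by
      refine ((hasDerivAt_pow (m + 1) x).mul (hasDerivAt_besselJ' (m + 1) x)).congr_deriv ?_
      have := mul_besselJ'_succ m x
      push_cast at this ⊢
      linear_combination x ^ m * this
    have hmono : StrictMonoOn (fun x => x ^ (m + 1) * besselJ (m + 1) x) (Ico 0 δ) := by
      refine strictMonoOn_of_deriv_pos (convex_Ico _ _)
        (fun x _ => (hd x).continuousAt.continuousWithinAt) fun x hx => ?_
      rw [interior_Ico] at hx
      rw [(hd x).deriv]
      exact mul_pos (pow_pos hx.1 _) (ih x hx)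
    intro x hx
    have := hmono (left_mem_Ico.2 hδ) ⟨hx.1.le, hx.2⟩ hx.1
    simp only [ne_eq, Nat.add_eq_zero_iff, one_ne_zero, and_false, not_false_eq_true, zero_pow,
      zero_mul] at this
    exact_mod_cast pos_of_mul_pos_right this (pow_nonneg hx.1.le _)

/-- This is Bessel's equation multiplied by `2 x J_m'`. Working with the recurrences instead avoids
dividing by `x`, so that 0 is included. -/
theorem hasDerivAt_besselJ_energy (m : ℤ) (x : ℝ) :
    HasDerivAt (fun x => (x * besselJ' m x) ^ 2 + (x ^ 2 - m ^ 2) * besselJ m x ^ 2)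
      (2 * (x * besselJ m x ^ 2)) x := by
  have hv : HasDerivAt (fun x => m * besselJ m x - x * besselJ (m + 1) x)
      (m * besselJ' m x - (1 * besselJ (m + 1) x + x * besselJ' (m + 1) x)) x :=
    ((hasDerivAt_besselJ' m x).const_mul _).sub
      ((hasDerivAt_id x).mul (hasDerivAt_besselJ' (m + 1) x))
  have e : (fun x => m * besselJ m x - x * besselJ (m + 1) x) = fun x => x * besselJ' m x :=
    funext fun x => (mul_besselJ'_eq_sub m x).symm
  rw [e] at hv
  refine ((hv.fun_pow 2).fun_add ((((hasDerivAt_id x).fun_pow 2).sub_const _).fun_mul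
    ((hasDerivAt_besselJ' m x).fun_pow 2))).congr_deriv ?_
  have h1 := mul_besselJ'_eq_sub m x
  have h2 := mul_besselJ'_succ m x
  simp only [id_eq, Nat.add_one_sub_one, Nat.cast_ofNat, pow_one, mul_one]
  linear_combination (-2 * x * besselJ' m x) * h2 + (2 * m * besselJ' m x) * h1

/-- The second case of Lommel's integral. -/
theorem two_mul_integral_mul_besselJ_sq (m : ℤ) (z : ℝ) :
    2 * ∫ x in (0 : ℝ)..z, x * besselJ m x ^ 2 =
      (z * besselJ' m z) ^ 2 + (z ^ 2 - m ^ 2) * besselJ m z ^ 2 := by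
  have := intervalIntegral.integral_eq_sub_of_hasDerivAt (a := 0) (b := z)
    (fun x _ => hasDerivAt_besselJ_energy m x) (Continuous.intervalIntegrable
      (by have := continuous_besselJ m; fun_prop) _ _)
  rw [intervalIntegral.integral_const_mul] at this
  rw [this]
  rcases eq_or_ne m 0 with rfl | hm
  · simp
  · simp [besselJ_zero_right hm]

theorem besselJ_sq_pos_near_zero (m : ℤ) : ∃ δ > 0, ∀ x ∈ Ioo 0 δ, 0 < besselJ m x ^ 2 := by
  obtain ⟨δ, hδ, h⟩ := exists_besselJ_pos
  refine ⟨δ, hδ, fun x hx => ?_⟩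
  obtain ⟨k, rfl | rfl⟩ := m.eq_nat_or_neg
  · have := h k x hx; positivity
  · have := h k x hx
    rw [besselJ_neg_int, mul_pow, ← zpow_natCast, ← zpow_mul, mul_comm, zpow_mul]
    norm_num
    positivity

/-- At a critical point the energy is the integral of `2 x J_m²`, which is positive. Both `z > |m|`
and `J_m(z) ≠ 0` follow. -/
theorem sq_sub_sq_mul_besselJ_sq_pos {m : ℤ} {z : ℝ} (hz : 0 < z) (h : besselJ' m z = 0) :
    0 < (z ^ 2 - m ^ 2) * besselJ m z ^ 2 := by
  have h1 := two_mul_integral_mul_besselJ_sq m z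
  rw [h, mul_zero, zero_pow two_ne_zero, zero_add] at h1
  rw [← h1]
  obtain ⟨δ, hδ, hp⟩ := besselJ_sq_pos_near_zero m
  have hmem : min z δ / 2 ∈ Ioo 0 δ := by
    have : 0 < min z δ := lt_min hz hδ
    constructor
    · positivity
    · linarith [min_le_right z δ]
  have hle : min z δ / 2 ≤ z := by linarith [min_le_left z δ, hmem.1]
  have := continuous_besselJ m
  refine mul_pos two_pos (intervalIntegral.integral_pos hz (by fun_prop) (fun x hx => ?_)
    ⟨_, ⟨hmem.1.le, hle⟩, mul_pos hmem.1 (hp _ hmem)⟩)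
  exact mul_nonneg hx.1.le (sq_nonneg _)

theorem sq_lt_sq_of_critical {m : ℤ} {z : ℝ} (hz : 0 < z) (h : besselJ' m z = 0) :
    (m : ℝ) ^ 2 < z ^ 2 :=
  sub_pos.1 (pos_of_mul_pos_left (sq_sub_sq_mul_besselJ_sq_pos hz h) (sq_nonneg _))

/-- The second derivative of `J_m` at a positive critical point. -/
theorem hasDerivAt_besselJ'_of_critical {m : ℤ} {z : ℝ} (hz : 0 < z) (h : besselJ' m z = 0) :
    HasDerivAt (besselJ' m) (-((z ^ 2 - m ^ 2) / z ^ 2 * besselJ m z)) z := by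
  have h1 := hasDerivAt_mul_besselJ' m hz.ne'
  have h2 := (hasDerivAt_id z).mul (differentiable_besselJ' m z).hasDerivAt
  have h3 := h1.unique h2
  simp only [h, mul_zero, zero_add, id_eq] at h3
  refine (differentiable_besselJ' m z).hasDerivAt.congr_deriv ?_
  field_simp at h3 ⊢
  linear_combination -h3

/-! ### The zeros of `J_m'`: unboundedness, isolation, enumeration. -/

/-- A continuous function without zeros on a preconnected set has a constant sign there. -/
theorem exists_sign_of_ne_zero {f : ℝ → ℝ} {S : Set ℝ} (hS : IsPreconnected S)
    (hf : ContinuousOn f S) (hne : ∀ x ∈ S, f x ≠ 0) :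
    ∃ s : ℝ, s ≠ 0 ∧ ∀ x ∈ S, 0 < s * f x := by
  rcases hS.mapsTo_Ioi_or_Iio hf hne with hp | hp
  · exact ⟨1, by norm_num, fun x hx => by linarith [mem_Ioi.1 (hp hx)]⟩
  · exact ⟨-1, by norm_num, fun x hx => by linarith [mem_Iio.1 (hp hx)]⟩

/-- `J_m'` has arbitrarily large zeros. -/
theorem exists_critical_gt (m : ℤ) (X : ℝ) : ∃ z > X, 0 < z ∧ besselJ' m z = 0 := by
  by_contra! hcon
  set Y := max X 0 with hY
  have hY0 : 0 ≤ Y := le_max_right _ _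
  obtain ⟨s, -, hs⟩ := exists_sign_of_ne_zero (isPreconnected_Ioi (a := Y))
    (continuous_besselJ' m).continuousOn fun x hx =>
      hcon x (lt_of_le_of_lt (le_max_left _ _) hx) (lt_of_le_of_lt hY0 hx)
  -- Beyond `Z` one has `x ≥ 1` and `x ≥ 2|m|`, so the coefficient `(x² - m²) / x` in Bessel's
  -- equation is at least `1 / 2`.
  set Z := Y + 1 + 2 * |(m : ℝ)| with hZ
  have hm0 : 0 ≤ |(m : ℝ)| := abs_nonneg _
  have hZ1 : 1 ≤ Z := by linarith
  have hZY : Y < Z := by linarith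
  have hZm (x : ℝ) (hx : Z ≤ x) : x / 2 ≤ (x ^ 2 - m ^ 2) / x := by
    have h2 : 2 * |(m : ℝ)| ≤ x := by linarith
    rw [le_div_iff₀ (by linarith), ← sq_abs (m : ℝ)]
    nlinarith
  have hy (x : ℝ) : HasDerivAt (fun x => s * besselJ m x) (s * besselJ' m x) x :=
    (hasDerivAt_besselJ' m x).const_mul s
  have hv (x : ℝ) (hx : Z ≤ x) : HasDerivAt (fun x => s * (x * besselJ' m x))
      (-((x ^ 2 - m ^ 2) / x * (s * besselJ m x))) x :=
    ((hasDerivAt_mul_besselJ' m (by linarith)).const_mul s).congr_deriv (by ring)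
  have hvpos (x : ℝ) (hx : Z ≤ x) : 0 < s * (x * besselJ' m x) := by
    rw [mul_left_comm]
    exact mul_pos (by linarith) (hs x (lt_of_lt_of_le hZY hx))
  have hmono : MonotoneOn (fun x => s * besselJ m x) (Ici Z) := by
    refine monotoneOn_of_deriv_nonneg (convex_Ici Z)
      (fun x _ => (hy x).continuousAt.continuousWithinAt)
      (fun x _ => (hy x).differentiableAt.differentiableWithinAt) fun x hx => ?_
    rw [interior_Ici] at hx
    rw [(hy x).deriv]
    exact (hs x (hZY.trans hx)).le
  by_cases hpos : ∃ x₀ ≥ Z, 0 < s * besselJ m x₀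
  -- If `s J_m` is positive at `x₀`, it stays at least `2c` afterwards, so `s x J_m'` decreases at
  -- rate at least `c` and cannot remain positive.
  · obtain ⟨x₀, hx₀, hp⟩ := hpos
    set c := s * besselJ m x₀ / 2 with hc
    have hcpos : 0 < c := by positivity
    have hd (x : ℝ) (hx : x₀ ≤ x) : HasDerivAt (fun x => s * (x * besselJ' m x) + c * x)
        (-((x ^ 2 - m ^ 2) / x * (s * besselJ m x)) + c * 1) x :=
      (hv x (hx₀.trans hx)).fun_add ((hasDerivAt_id x).const_mul c)
    have hanti : AntitoneOn (fun x => s * (x * besselJ' m x) + c * x) (Ici x₀) := by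
      refine antitoneOn_of_deriv_nonpos (convex_Ici x₀)
        (fun x hx => (hd x hx).continuousAt.continuousWithinAt)
        (fun x hx => (hd x (interior_subset hx)).differentiableAt.differentiableWithinAt)
        fun x hx => ?_
      have hx' : x₀ ≤ x := interior_subset hx
      rw [(hd x hx').deriv]
      have h1 : s * besselJ m x₀ ≤ s * besselJ m x := hmono hx₀ (hx₀.le.trans hx') hx'
      have h2 := hZm x (hx₀.le.trans hx')
      have h3 : 1 / 2 * (s * besselJ m x₀) ≤ (x ^ 2 - m ^ 2) / x * (s * besselJ m x) :=
        mul_le_mul (by linarith) h1 hp.le (by linarith)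
      linarith
    -- The point at which the linear upper bound for `s x J_m'` reaches zero.
    set x := x₀ + s * (x₀ * besselJ' m x₀) / c with hx
    have hxx : x₀ ≤ x := by
      have := hvpos x₀ hx₀
      rw [hx]; linarith [div_pos this hcpos]
    have h1 := hanti self_mem_Ici hxx hxx
    have h2 := hvpos x (hx₀.le.trans hxx)
    have h3 : c * x = c * x₀ + s * (x₀ * besselJ' m x₀) := by rw [hx]; field_simp
    simp only at h1
    linarith
  -- If `s J_m ≤ 0` throughout, then `s x J_m'` is nondecreasing, so `s J_m' ≥ c / x`, and `s J_m`
  -- outgrows `c log x` up to a constant, contradicting its sign.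
  · push Not at hpos
    set c := s * (Z * besselJ' m Z) with hc
    have hcpos : 0 < c := hvpos Z le_rfl
    have hvmono : MonotoneOn (fun x => s * (x * besselJ' m x)) (Ici Z) := by
      refine monotoneOn_of_deriv_nonneg (convex_Ici Z)
        (fun x hx => (hv x hx).continuousAt.continuousWithinAt)
        (fun x hx => (hv x (interior_subset hx)).differentiableAt.differentiableWithinAt)
        fun x hx => ?_
      have hx' : Z ≤ x := interior_subset hx
      rw [(hv x hx').deriv]
      have h1 := hZm x hx'
      have h2 := hpos x hx'
      have h3 : 0 ≤ (x ^ 2 - m ^ 2) / x := by linarith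
      nlinarith [mul_nonneg h3 (neg_nonneg.2 h2)]
    have hd (x : ℝ) (hx : Z ≤ x) : HasDerivAt (fun x => s * besselJ m x - c * Real.log x)
        (s * besselJ' m x - c * x⁻¹) x :=
      (hy x).fun_sub ((Real.hasDerivAt_log (by linarith)).const_mul c)
    have hmono' : MonotoneOn (fun x => s * besselJ m x - c * Real.log x) (Ici Z) := by
      refine monotoneOn_of_deriv_nonneg (convex_Ici Z)
        (fun x hx => (hd x hx).continuousAt.continuousWithinAt)
        (fun x hx => (hd x (interior_subset hx)).differentiableAt.differentiableWithinAt)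
        fun x hx => ?_
      have hx' : Z ≤ x := interior_subset hx
      rw [(hd x hx').deriv]
      have h1 : c ≤ s * (x * besselJ' m x) := hvmono self_mem_Ici hx' hx'
      have hx0 : 0 < x := by linarith
      have h2 : s * besselJ' m x - c * x⁻¹ = (s * (x * besselJ' m x) - c) / x := by
        field_simp
      rw [h2]
      exact div_nonneg (by linarith) hx0.le
    obtain ⟨x, hx1, hx2⟩ := ((Real.tendsto_log_atTop.eventually_gt_atTop
      (Real.log Z - s * besselJ m Z / c)).and (eventually_ge_atTop Z)).exists
    have h1 := hmono' self_mem_Ici hx2 hx2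
    have h2 := hpos x hx2
    simp only at h1
    have h3 : c * (Real.log Z - s * besselJ m Z / c) < c * Real.log x :=
      mul_lt_mul_of_pos_left hx1 hcpos
    have h4 : c * (Real.log Z - s * besselJ m Z / c) = c * Real.log Z - s * besselJ m Z := by
      field_simp
    linarith

/-- Every admissible zero is a strict extremum of `J_m`: a maximum where `J_m > 0`, a minimum where
`J_m < 0`. The zero at the origin for `m = 0` is treated apart, with `J_0''(0) = -1/2`. -/
theorem hasDerivAt_besselJ'_of_mem_derivZeros {m : ℤ} {z : ℝ} (hz : z ∈ derivZeros m) :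
    ∃ d, HasDerivAt (besselJ' m) d z ∧ d * besselJ m z < 0 := by
  rcases hz with ⟨h, hz | ⟨rfl, rfl⟩⟩
  · refine ⟨_, hasDerivAt_besselJ'_of_critical hz h, ?_⟩
    have := sq_sub_sq_mul_besselJ_sq_pos hz h
    have h2 : -((z ^ 2 - m ^ 2) / z ^ 2 * besselJ m z) * besselJ m z =
      -(((z ^ 2 - m ^ 2) * besselJ m z ^ 2) / z ^ 2) := by ring
    rw [h2]
    exact neg_neg_of_pos (by positivity)
  · have e : besselJ' 0 = fun x => (besselJ (0 - 1) x - besselJ (0 + 1) x) / 2 :=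
      funext (besselJ'_eq 0)
    refine ⟨_, e ▸ ((hasDerivAt_besselJ (0 - 1) 0).fun_sub
      (hasDerivAt_besselJ (0 + 1) 0)).div_const 2, ?_⟩
    norm_num [besselJ_zero_zero, besselJ_zero_right]

/-- The recursion step of `besselZero` attains its infimum. -/
theorem isLeast_sInf_derivZeros {m : ℤ} {z : ℝ} (hz : z = -1 ∨ z ∈ derivZeros m) :
    IsLeast {x | x ∈ derivZeros m ∧ z < x} (sInf {x | x ∈ derivZeros m ∧ z < x}) := by
  set T := {x | x ∈ derivZeros m ∧ z < x} with hT
  have hne : T.Nonempty := by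
    obtain ⟨w, hw, hw0, h⟩ := exists_critical_gt m z
    exact ⟨w, ⟨h, .inl hw0⟩, hw⟩
  have hbdd : BddBelow T := ⟨z, fun x hx => hx.2.le⟩
  set w := sInf T with hw
  have hcl : w ∈ closure T := csInf_mem_closure hne hbdd
  -- The bound `|m| ≤ x` survives in the closure and prevents the infimum from being an inadmissible
  -- zero at the origin when `m ≠ 0`.
  have habs : |(m : ℝ)| ≤ w := by
    refine closure_minimal (fun x hx => ?_) isClosed_Ici hcl
    rcases hx.1 with ⟨h, hx | ⟨rfl, rfl⟩⟩
    · exact (abs_lt_of_sq_lt_sq (sq_lt_sq_of_critical hx h) hx.le).le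
    · simp
  have hJ : besselJ' m w = 0 :=
    closure_minimal (fun x hx => hx.1.1) (isClosed_singleton.preimage (continuous_besselJ' m)) hcl
  have hwS : w ∈ derivZeros m := by
    refine ⟨hJ, ?_⟩
    rcases eq_or_ne m 0 with rfl | hm
    · rcases (abs_nonneg _ |>.trans habs).eq_or_lt with h | h
      · exact .inr ⟨rfl, h.symm⟩
      · exact .inl h
    · have : 0 < |(m : ℝ)| := abs_pos.2 (by exact_mod_cast hm)
      exact .inl (by linarith)
  refine ⟨⟨hwS, lt_of_le_of_ne (le_csInf hne fun x hx => hx.2.le) ?_⟩, fun x hx => csInf_le hbdd hx⟩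
  -- If the infimum were `z` itself, zeros of `J_m'` would accumulate at it, although the derivative
  -- of `J_m'` there is nonzero.
  intro hzw
  obtain ⟨d, hd, hdJ⟩ := hasDerivAt_besselJ'_of_mem_derivZeros hwS
  have hev := hd.eventually_ne (c := 0) (by rintro rfl; simp at hdJ)
  have hfr : ∃ᶠ x in 𝓝[≠] w, x ∈ T := by
    rw [frequently_nhdsWithin_iff]
    refine (mem_closure_iff_frequently.1 hcl).mono fun x hx => ⟨hx, ?_⟩
    exact (hzw ▸ hx.2).ne'
  obtain ⟨x, hx, hx'⟩ := (hfr.and_eventually hev).exists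
  exact hx' hx.1.1

theorem besselZero_mem (m : ℤ) (n : ℕ) : besselZero m (n + 1) ∈ derivZeros m := by
  induction n with
  | zero => exact (isLeast_sInf_derivZeros (.inl rfl)).1.1
  | succ n ih => exact (isLeast_sInf_derivZeros (.inr ih)).1.1

theorem isLeast_besselZero (m : ℤ) (n : ℕ) :
    IsLeast {x | x ∈ derivZeros m ∧ besselZero m n < x} (besselZero m (n + 1)) := by
  cases n with
  | zero => exact isLeast_sInf_derivZeros (.inl rfl)
  | succ n => exact isLeast_sInf_derivZeros (.inr (besselZero_mem m n))

theorem besselZero_nonneg (m : ℤ) (n : ℕ) : 0 ≤ besselZero m (n + 1) := by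
  rcases (besselZero_mem m n).2 with h | h
  · exact h.le
  · exact h.2.ge

/-! ### The sign of `J_m` at the zeros of `J_m'`. -/

theorem eventually_sign_of_hasDerivAt_neg {f : ℝ → ℝ} {d z : ℝ} (hf : HasDerivAt f d z)
    (h0 : f z = 0) (hd : d < 0) :
    (∀ᶠ x in 𝓝[>] z, f x < 0) ∧ ∀ᶠ x in 𝓝[<] z, 0 < f x := by
  have h := (hasDerivAt_iff_tendsto_slope.1 hf).eventually_lt_const hd
  simp only [slope_def_field, h0, sub_zero] at h
  constructor
  · filter_upwards [h.filter_mono (nhdsWithin_mono z fun x (hx : z < x) => hx.ne'),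
      self_mem_nhdsWithin] with x hx hzx
    exact ((div_neg_iff.1 hx).resolve_left fun h => by linarith [h.2, mem_Ioi.1 hzx]).1
  · filter_upwards [h.filter_mono (nhdsWithin_mono z fun x (hx : x < z) => hx.ne),
      self_mem_nhdsWithin] with x hx hzx
    exact ((div_neg_iff.1 hx).resolve_right fun h => by linarith [h.2, mem_Iio.1 hzx]).1

theorem besselJ_ne_zero_of_mem_derivZeros {m : ℤ} {z : ℝ} (hz : z ∈ derivZeros m) :
    besselJ m z ≠ 0 := by
  obtain ⟨d, -, hd⟩ := hasDerivAt_besselJ'_of_mem_derivZeros hz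
  intro h; simp [h] at hd

/-- The values of `J_m` at consecutive zeros of `J_m'` have opposite signs. -/
theorem besselJ_consecutive_critical {m : ℤ} {z w s : ℝ} (hz : z ∈ derivZeros m)
    (hw : IsLeast {x | x ∈ derivZeros m ∧ z < x} w) (hs : 0 < s * besselJ m z) :
    s * besselJ m w < 0 := by
  obtain ⟨d, hd, hdJ⟩ := hasDerivAt_besselJ'_of_mem_derivZeros hz
  obtain ⟨e, he, heJ⟩ := hasDerivAt_besselJ'_of_mem_derivZeros hw.1.1
  have hz0 : 0 ≤ z := by
    rcases hz.2 with h | h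
    · exact h.le
    · exact h.2.ge
  have hs2 : 0 < s ^ 2 := by
    have : s ≠ 0 := by rintro rfl; simp at hs
    positivity
  obtain ⟨σ, -, hσ⟩ := exists_sign_of_ne_zero (isPreconnected_Ioo (a := z) (b := w))
    (continuous_besselJ' m).continuousOn fun x hx h =>
      not_le_of_gt hx.2 (hw.2 ⟨⟨h, .inl (hz0.trans_lt hx.1)⟩, hx.1⟩)
  refine lt_of_le_of_ne (le_of_not_gt fun hpos => ?_)
    (mul_ne_zero (by rintro rfl; simp at hs) (besselJ_ne_zero_of_mem_derivZeros hw.1.1))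
  have key (u c : ℝ) (h1 : c * besselJ m u < 0) (h2 : 0 < s * besselJ m u) : s * c < 0 := by
    nlinarith [mul_pos_of_neg_of_neg h1 (neg_neg_of_pos h2), sq_nonneg (besselJ m u)]
  -- If `s J_m` were positive at both ends, `s J_m'` would be negative just after `z` and positive
  -- just before `w`, against its constant sign in between.
  have h1 := (eventually_sign_of_hasDerivAt_neg (hd.const_mul s) (by simp [hz.1])
    (key _ _ hdJ hs)).1
  have h2 := (eventually_sign_of_hasDerivAt_neg (he.const_mul s) (by simp [hw.1.1.1])
    (key _ _ heJ hpos)).2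
  obtain ⟨x, hx, hx'⟩ := (h1.and (Ioo_mem_nhdsGT hw.1.2)).exists
  obtain ⟨y, hy, hy'⟩ := (h2.and (Ioo_mem_nhdsLT hw.1.2)).exists
  have h3 := hσ x hx'
  have h4 := hσ y hy'
  have h5 : 0 < besselJ' m x * besselJ' m y :=
    pos_of_mul_pos_right (a := σ ^ 2) (by linarith [mul_pos h3 h4]) (sq_nonneg σ)
  linarith [mul_pos hs2 h5, mul_neg_of_neg_of_pos hx hy]

/-- Signs alternate, so only the first zero matters. For `m = 0` it is 0, where `J_0 = 1`. For `m >
0`, `J_m` starts from 0 and is strictly monotone up to the first zero, so it keeps the positive sign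
it has near 0. -/
theorem besselJ_besselZero_sign_nat (m : ℕ) (n : ℕ) :
    0 < (-1 : ℝ) ^ n * besselJ m (besselZero m (n + 1)) := by
  induction n with
  | zero =>
    have hl := isLeast_besselZero m 0
    rw [pow_zero, one_mul, zero_add] at *
    rcases Nat.eq_zero_or_pos m with rfl | hm
    · have : besselZero (0 : ℕ) 1 = 0 := by
        refine hl.unique ⟨⟨⟨?_, .inr ⟨rfl, rfl⟩⟩, by simp [besselZero]⟩, fun x hx => ?_⟩
        · simp [besselJ'_eq, besselJ_zero_right]
        · rcases hx.1.2 with h | h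
          · exact h.le
          · exact h.2.ge
      rw [this, Nat.cast_zero, besselJ_zero_zero]
      norm_num
    · have hm' : (m : ℤ) ≠ 0 := by exact_mod_cast hm.ne'
      set w := besselZero m 1 with hw
      have hw0 : 0 < w := hl.1.1.2.resolve_right fun h => hm' h.1
      obtain ⟨σ, -, hσ⟩ := exists_sign_of_ne_zero (isPreconnected_Ioo (a := 0) (b := w))
        (continuous_besselJ' m).continuousOn fun x hx h =>
          not_le_of_gt hx.2 (hl.2 ⟨⟨h, .inl hx.1⟩, by
            change (-1 : ℝ) < x; linarith [hx.1]⟩)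
      have hmono : StrictMonoOn (fun x => σ * besselJ m x) (Icc 0 w) := by
        refine strictMonoOn_of_deriv_pos (convex_Icc _ _)
          (by have := continuous_besselJ m; fun_prop) fun x hx => ?_
        rw [interior_Icc] at hx
        rw [((hasDerivAt_besselJ' m x).const_mul σ).deriv]
        exact hσ x hx
      have hpos (x : ℝ) (hx : x ∈ Ioc 0 w) : 0 < σ * besselJ m x := by
        simpa [besselJ_zero_right hm'] using hmono (left_mem_Icc.2 hw0.le) ⟨hx.1.le, hx.2⟩ hx.1
      obtain ⟨δ, hδ, hJ⟩ := exists_besselJ_pos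
      have hmin : 0 < min w δ := lt_min hw0 hδ
      have h1 := hpos (min w δ / 2) ⟨by positivity, by linarith [min_le_left w δ]⟩
      have h2 := hJ m (min w δ / 2) ⟨by positivity, by linarith [min_le_right w δ]⟩
      exact pos_of_mul_pos_right (hpos w ⟨hw0, le_rfl⟩) (pos_of_mul_pos_left h1 h2.le).le
  | succ n ih =>
    have := besselJ_consecutive_critical (besselZero_mem m n) (isLeast_besselZero m (n + 1)) ih
    rw [pow_succ]
    linarith

theorem besselJ'_neg_int (m : ℤ) (x : ℝ) : besselJ' (-m) x = (-1) ^ m * besselJ' m x := by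
  have : besselJ (-m) = fun x => (-1) ^ m * besselJ m x := funext (besselJ_neg_int m)
  rw [besselJ', this, deriv_const_mul _ (hasDerivAt_besselJ m x).differentiableAt, besselJ']

theorem derivZeros_neg (m : ℤ) : derivZeros (-m) = derivZeros m := by
  ext x
  have : (-1 : ℝ) ^ m ≠ 0 := zpow_ne_zero _ (by norm_num)
  simp [derivZeros, besselJ'_neg_int, this]

theorem besselZero_neg (m : ℤ) (n : ℕ) : besselZero (-m) n = besselZero m n := by
  induction n with
  | zero => rfl
  | succ n ih => simp only [besselZero, ih, derivZeros_neg]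

/-- `signFactor n m` is the sign of `J_m(z_{mn})`. -/
theorem signFactor_mul_abs_besselJ (m : ℤ) (n : ℕ) :
    besselJ m (besselZero m (n + 1)) =
      signFactor (n + 1) m * |besselJ m (besselZero m (n + 1))| := by
  have nat (k : ℕ) : besselJ k (besselZero k (n + 1)) =
      (-1) ^ n * |besselJ k (besselZero k (n + 1))| := by
    have h := besselJ_besselZero_sign_nat k n
    rcases neg_one_pow_eq_or ℝ n with h1 | h1 <;> rw [h1] at h ⊢
    · rw [one_mul] at h ⊢; rw [abs_of_pos h]
    · rw [abs_of_neg (by linarith)]; ring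
  obtain ⟨k, rfl | rfl⟩ := m.eq_nat_or_neg
  · simpa [signFactor] using nat k
  · rcases Nat.eq_zero_or_pos k with rfl | hk
    · simpa [signFactor] using nat 0
    · have hk' : ¬ (0 : ℤ) ≤ -k := by omega
      rw [besselZero_neg, besselJ_neg_int, abs_mul, abs_zpow, signFactor, if_neg hk']
      simp only [abs_neg, abs_one, one_zpow, one_mul, add_tsub_cancel_right, zpow_neg]
      nth_rewrite 1 [nat k]
      rcases neg_one_pow_eq_or ℝ k with h1 | h1 <;> simp [h1]

/-! ### Lommel's integral and the radial overlap. -/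

/-- The first case of Lommel's integral. -/
theorem sq_sub_sq_mul_integral_besselJ (m : ℤ) (α β : ℝ) {a : ℝ} (ha : 0 ≤ a) :
    (α ^ 2 - β ^ 2) * ∫ r in (0 : ℝ)..a, besselJ m (α * r) * besselJ m (β * r) * r =
      besselJ m (α * a) * (β * a * besselJ' m (β * a)) -
        α * a * besselJ' m (α * a) * besselJ m (β * a) := by
  have hlin (c x : ℝ) : HasDerivAt (fun x => c * x) c x := by
    simpa using (hasDerivAt_id x).const_mul c
  have hJ (c x : ℝ) : HasDerivAt (fun x => besselJ m (c * x)) (besselJ' m (c * x) * c) x :=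
    (hasDerivAt_besselJ' m (c * x)).comp x (hlin c x)
  have hV (c x : ℝ) : HasDerivAt (fun x => c * x * besselJ' m (c * x))
      (deriv (fun u => u * besselJ' m u) (c * x) * c) x :=
    HasDerivAt.comp (h₂ := fun u => u * besselJ' m u) x
      (differentiable_id.mul (differentiable_besselJ' m) (c * x)).hasDerivAt (hlin c x)
  -- Multiplying by `x` gives a form of Bessel's equation that also holds for `c = 0`, where `m²
  -- J_m(0) = 0`; the frequency 0 does occur, for `k = 0` and for `z_{01}`.
  have hD (c x : ℝ) (hx : 0 < x) :
      x * (deriv (fun u => u * besselJ' m u) (c * x) * c) =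
        (m ^ 2 - c ^ 2 * x ^ 2) * besselJ m (c * x) := by
    rcases eq_or_ne c 0 with rfl | hc
    · rcases eq_or_ne m 0 with rfl | hm
      · simp
      · simp [besselJ_zero_right hm]
    · rw [(hasDerivAt_mul_besselJ' m (mul_ne_zero hc hx.ne')).deriv]
      field_simp
  have hc := continuous_besselJ m
  have hc' := continuous_besselJ' m
  have := intervalIntegral.integral_eq_sub_of_hasDerivAt_of_le
    (f := fun x => besselJ m (α * x) * (β * x * besselJ' m (β * x)) -
      α * x * besselJ' m (α * x) * besselJ m (β * x))
    (f' := fun r => (α ^ 2 - β ^ 2) * (besselJ m (α * r) * besselJ m (β * r) * r)) ha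
    (by fun_prop) (fun x hx => ?_) (Continuous.intervalIntegrable (by fun_prop) _ _)
  · rw [← intervalIntegral.integral_const_mul, this]
    simp
  · refine (((hJ α x).fun_mul (hV β x)).fun_sub ((hV α x).fun_mul (hJ β x))).congr_deriv ?_
    apply mul_left_cancel₀ hx.1.ne'
    linear_combination besselJ m (α * x) * hD β x hx.1 - besselJ m (β * x) * hD α x hx.1

/-- The radial overlap integral, with `z = z_{mn}`. -/
theorem integral_besselJ_besselZero (m : ℤ) (n : ℕ) {a : ℝ} (ha : 0 < a) (t : ℝ) (ht : 0 ≤ t) :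
    ∫ r in (0 : ℝ)..a, besselJ m (rho a (n + 1) m * r) * besselJ m (t / a * r) * r =
      a ^ 2 * besselJ m (besselZero m (n + 1)) * besselQuot (n + 1) m t := by
  set z := besselZero m (n + 1) with hz
  have hzm : z ∈ derivZeros m := besselZero_mem m n
  have hρ : rho a (n + 1) m = z / a := by rw [rho, inv_mul_eq_div]
  rw [hρ, besselQuot, ← hz]
  split_ifs with h
  -- For equal frequencies the factor `z² - t²` vanishes, so the second Lommel integral is rescaled
  -- instead; this needs `z ≠ 0`, and at `z = 0` the integrand is just `r`.
  · rw [h]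
    have h1 := intervalIntegral.integral_comp_mul_deriv (a := 0) (b := a)
      (f := fun r => z / a * r) (f' := fun _ => z / a) (g := fun x => x * besselJ m x ^ 2)
      (fun x _ => by simpa using (hasDerivAt_id x).const_mul (z / a)) (by fun_prop)
      (by have := continuous_besselJ m; fun_prop)
    rw [mul_zero, div_mul_cancel₀ _ ha.ne'] at h1
    have h2 := two_mul_integral_mul_besselJ_sq m z
    rw [hzm.1, mul_zero, zero_pow two_ne_zero, zero_add, ← h1] at h2
    rcases hzm.2 with h0 | ⟨rfl, h0⟩
    · have h3 : ∫ x in (0 : ℝ)..a, ((fun x => x * besselJ m x ^ 2) ∘ fun r => z / a * r) x * (z / a) =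
          (z / a) ^ 2 * ∫ r in (0 : ℝ)..a, besselJ m (z / a * r) * besselJ m (z / a * r) * r := by
        rw [← intervalIntegral.integral_const_mul]
        exact intervalIntegral.integral_congr fun x _ => by simp only [Function.comp_apply]; ring
      rw [h3] at h2
      field_simp at h2 ⊢
      linear_combination h2
    · rw [h0]
      simp [besselJ_zero_zero]
      ring
  · have h1 := sq_sub_sq_mul_integral_besselJ m (z / a) (t / a) ha.le
    rw [div_mul_cancel₀ _ ha.ne', div_mul_cancel₀ _ ha.ne', hzm.1] at h1
    have h2 : z ^ 2 - t ^ 2 ≠ 0 := by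
      have : z + t ≠ 0 := by
        intro h0
        exact h (by linarith [besselZero_nonneg m n])
      rw [sq_sub_sq]
      exact mul_ne_zero this (sub_ne_zero.2 (Ne.symm h))
    field_simp at h1 ⊢
    linear_combination h1

/-! ### Polar coordinates on a disk. -/

/-- The measurable identification of the Euclidean plane with `ℝ × ℝ`. -/
noncomputable def planeEquiv : Plane ≃ᵐ ℝ × ℝ :=
  (MeasurableEquiv.toLp 2 (Fin 2 → ℝ)).symm.trans MeasurableEquiv.finTwoArrow

theorem measurePreserving_planeEquiv : MeasurePreserving planeEquiv :=
  (volume_preserving_finTwoArrow ℝ).comp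
    (PiLp.volume_preserving_ofLp (Fin 2))

theorem norm_polar (r θ : ℝ) : ‖polar r θ‖ = |r| := by
  rw [polar, EuclideanSpace.norm_eq, Fin.sum_univ_two]
  simp only [Real.norm_eq_abs, sq_abs]
  have : (r * Real.cos θ) ^ 2 + (r * Real.sin θ) ^ 2 = r ^ 2 := by
    linear_combination r ^ 2 * Real.sin_sq_add_cos_sq θ
  simpa [this] using Real.sqrt_sq_eq_abs r

theorem polar_mem_disk {r R θ : ℝ} (hr : 0 ≤ r) : polar r θ ∈ disk R ↔ r ≤ R := by
  rw [disk, mem_closedBall_zero_iff, norm_polar, abs_of_nonneg hr]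

theorem polar_periodic (r : ℝ) : Function.Periodic (polar r) (2 * π) := fun θ => by
  simp [polar]

/-- Integration over a disk in polar coordinates. -/
theorem setIntegral_disk_eq_polar {g : Plane → ℂ} {R : ℝ} (hR : 0 ≤ R)
    (hg : IntegrableOn g (disk R)) :
    ∫ x in disk R, g x =
      ∫ r in (0 : ℝ)..R, ∫ θ in (0 : ℝ)..(2 * π), g (polar r θ) * (r : ℂ) := by
  have hmeas : MeasurableSet (disk R) := Metric.isClosed_closedBall.measurableSet
  set h := (disk R).indicator g with hh
  have hint : Integrable h := (integrable_indicator_iff hmeas).2 hg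
  have hH : Integrable fun p : ℝ × ℝ => h (planeEquiv.symm p) :=
    (measurePreserving_planeEquiv.symm.integrable_comp_emb
      planeEquiv.symm.measurableEmbedding).2 hint
  have e1 : ∫ x in disk R, g x = ∫ p : ℝ × ℝ, h (planeEquiv.symm p) := by
    rw [← integral_indicator hmeas, measurePreserving_planeEquiv.symm.integral_comp
      planeEquiv.symm.measurableEmbedding]
  have hsymm (p : ℝ × ℝ) : planeEquiv.symm (polarCoord.symm p) = polar p.1 p.2 := rfl
  have htar : polarCoord.target = Ioi (0 : ℝ) ×ˢ Ioo (-π) π := rfl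
  -- Integrability in polar coordinates, needed for Fubini, comes from the change of variables with
  -- Jacobian `r`.
  have hI : IntegrableOn (fun p : ℝ × ℝ => p.1 • h (polar p.1 p.2)) polarCoord.target := by
    have := (integrableOn_image_iff_integrableOn_abs_det_fderiv_smul volume
      polarCoord.open_target.measurableSet
      (fun p _ => (hasFDerivAt_polarCoord_symm p).hasFDerivWithinAt)
      polarCoord.symm.injOn (fun p => h (planeEquiv.symm p))).1 hH.integrableOn
    refine this.congr_fun (fun p hp => ?_) polarCoord.open_target.measurableSet
    simp only [det_fderivPolarCoordSymm, hsymm]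
    rw [abs_of_pos hp.1]
  rw [e1, ← integral_comp_polarCoord_symm]
  simp only [hsymm]
  rw [htar] at hI ⊢
  rw [Measure.volume_eq_prod, setIntegral_prod _ (by rwa [← Measure.volume_eq_prod]),
    intervalIntegral.integral_of_le hR]
  have hsub : ∫ r in Ioi (0 : ℝ), ∫ θ in Ioo (-π) π, r • h (polar r θ) =
      ∫ r in Ioc 0 R, ∫ θ in Ioo (-π) π, r • h (polar r θ) := by
    refine (setIntegral_eq_of_subset_of_forall_sdiff_eq_zero measurableSet_Ioi
      (fun r hr => hr.1) fun r hr => ?_)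
    have : R < r := not_le.1 fun h => hr.2 ⟨hr.1, h⟩
    simp only [hh]
    simp [indicator_of_notMem, polar_mem_disk (mem_Ioi.1 hr.1).le, this]
  rw [hsub]
  refine setIntegral_congr_fun measurableSet_Ioc fun r hr => ?_
  -- The polar chart uses angles in `(-π, π)`; periodicity moves the integral to `[0, 2π]`.
  have hp : Function.Periodic (fun θ => g (polar r θ) * (r : ℂ)) (2 * π) := fun θ => by
    simp only [polar_periodic r θ]
  have h2 := hp.intervalIntegral_add_eq (-π) 0
  rw [zero_add, show -π + 2 * π = π by ring] at h2
  rw [← h2, intervalIntegral.integral_of_le (by linarith [Real.pi_pos]), integral_Ioc_eq_integral_Ioo]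
  refine integral_congr_ae (.of_forall fun θ => ?_)
  simp only [hh, indicator_of_mem ((polar_mem_disk hr.1.le).2 hr.2), Complex.real_smul, mul_comm]

/-! ### Parseval's identity on the square of side `2a`. -/

/-- The character `x ↦ exp(π i k · x / a)`, which is `2a`-periodic in both coordinates. -/
noncomputable def planeChar (a : ℝ) (k : ℤ × ℤ) (x : Plane) : ℂ :=
  Complex.exp (((π / a * (k.1 * x 0 + k.2 * x 1) : ℝ) : ℂ) * Complex.I)

theorem continuous_planeChar (a : ℝ) (k : ℤ × ℤ) : Continuous (planeChar a k) := by
  unfold planeChar; fun_prop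

theorem norm_planeChar (a : ℝ) (k : ℤ × ℤ) (x : Plane) : ‖planeChar a k x‖ = 1 :=
  Complex.norm_exp_ofReal_mul_I _

theorem planeChar_add (a : ℝ) (k : ℤ × ℤ) (x y : Plane) :
    planeChar a k (x + y) = planeChar a k x * planeChar a k y := by
  rw [planeChar, planeChar, planeChar, ← Complex.exp_add]
  congr 1
  simp
  ring

/-- The half-open square `(-a, a]²`. -/
def square (a : ℝ) : Set Plane := {x | ∀ i, x i ∈ Ioc (-a) a}

/-- The closed disk leaves the half-open square only at points of its boundary circle, which is a
null set. -/
theorem ae_eq_zero_of_notMem_square {a : ℝ} {f : Plane → ℂ}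
    (hf : ∀ x, x ∉ disk a → f x = 0) : ∀ᵐ x, x ∉ square a → f x = 0 := by
  have h : ∀ᵐ x : Plane, x ∉ Metric.sphere 0 a := by
    rw [ae_iff]
    simp only [not_not]
    exact Measure.addHaar_sphere volume (0 : Plane) a
  filter_upwards [h] with x hx hxs
  refine hf x fun hxd => hxs fun i => ?_
  rw [disk, mem_closedBall_zero_iff] at hxd
  rw [mem_sphere_zero_iff_norm] at hx
  have h1 : |x i| < a := lt_of_le_of_lt (PiLp.norm_apply_le x i) (lt_of_le_of_ne hxd hx)
  exact ⟨(abs_lt.1 h1).1, (abs_lt.1 h1).2.le⟩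

section Torus

attribute [local instance] instMeasureSpaceUnitAddCircle

/-- The parametrization of the square `(-a, a]²` by the unit torus. -/
noncomputable def torusToPlane (a : ℝ) (t : UnitAddTorus (Fin 2)) : Plane :=
  (2 * a) • WithLp.toLp 2 fun i => (AddCircle.equivIoc 1 (-1 / 2 : ℝ) (t i)).1

/-- The torus carries Lebesgue measure of the unit square centred at 0; dilation by `2a` multiplies
area by `4a²`. -/
theorem map_torusToPlane {a : ℝ} (ha : 0 < a) :
    Measurable (torusToPlane a) ∧ Measure.map (torusToPlane a) volume =
      ENNReal.ofReal (4 * a ^ 2)⁻¹ • volume.restrict (square a) := by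
  have h1 := (measurePreserving_subtype_coe (μa := (volume : Measure (Fin 2 → ℝ)))
    (s := {x | ∀ i, x i ∈ Ioc (-1 / 2 : ℝ) (-1 / 2 + 1)})
    (MeasurableSet.univ_pi' fun _ : Fin 2 => measurableSet_Ioc)).comp
    (UnitAddTorus.measurePreserving_equivPiIoc (fun _ : Fin 2 => (-1 / 2 : ℝ)))
  have h2 := (PiLp.volume_preserving_toLp (Fin 2)).restrict_preimage
    ((MeasurableSet.univ_pi' fun _ : Fin 2 => measurableSet_Ioc (a := (-1 / 2 : ℝ))
      (b := -1 / 2 + 1)).preimage (MeasurableEquiv.toLp 2 (Fin 2 → ℝ)).symm.measurable)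
  have h3 := h2.comp h1
  have hsm : MeasurableEmbedding fun x : Plane => (2 * a) • x :=
    (MeasurableEquiv.smul₀ (2 * a) (by positivity)).measurableEmbedding
  have he : torusToPlane a = (fun x : Plane => (2 * a) • x) ∘ (WithLp.toLp 2 ∘
      (Subtype.val ∘ UnitAddTorus.measurableEquivPiIoc fun _ : Fin 2 => (-1 / 2 : ℝ))) := rfl
  refine ⟨he ▸ hsm.measurable.comp h3.measurable, ?_⟩
  rw [he]
  refine (Measure.map_map hsm.measurable h3.measurable).symm.trans ?_
  rw [h3.map_eq]
  have h4 := Measure.map_addHaar_smul (volume : Measure Plane) (r := 2 * a) (by positivity)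
  rw [finrank_euclideanSpace_fin, abs_of_pos (by positivity)] at h4
  have h5 : ((2 * a) ^ 2)⁻¹ = (4 * a ^ 2)⁻¹ := by ring
  rw [h5] at h4
  rw [← Measure.restrict_smul, ← h4, hsm.restrict_map]
  congr 2
  ext x
  simp only [mem_preimage, square, mem_ofPred_eq, MeasurableEquiv.coe_toLp_symm, PiLp.smul_apply,
    smul_eq_mul]
  refine forall_congr' fun i => ?_
  simp only [mem_Ioc]
  constructor <;> rintro ⟨h, h'⟩ <;> constructor <;> nlinarith

theorem integral_comp_torusToPlane {a : ℝ} (ha : 0 < a) {f : Plane → ℂ}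
    (hf : AEStronglyMeasurable f) (h0 : ∀ x, x ∉ disk a → f x = 0) :
    ∫ t, f (torusToPlane a t) = ((4 * a ^ 2)⁻¹ : ℝ) * ∫ x, f x := by
  obtain ⟨hm, hmap⟩ := map_torusToPlane ha
  rw [← integral_map hm.aemeasurable (by
    rw [hmap]; exact hf.restrict.smul_measure _), hmap, integral_smul_measure,
    setIntegral_eq_integral_of_ae_compl_eq_zero (ae_eq_zero_of_notMem_square h0),
    ENNReal.toReal_ofReal (by positivity), Complex.real_smul]

theorem memLp_comp_torusToPlane {a : ℝ} (ha : 0 < a) {f : Plane → ℂ} (hf : MemLp f 2) :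
    MemLp (fun t => f (torusToPlane a t)) 2 := by
  obtain ⟨hm, hmap⟩ := map_torusToPlane ha
  have : MemLp f 2 (Measure.map (torusToPlane a) volume) := by
    rw [hmap]
    exact hf.restrict _ |>.smul_measure ENNReal.ofReal_ne_top
  exact (memLp_map_measure_iff this.1 hm.aemeasurable).1 this

/-- With `x = 2a s`, the phase `2π k·s` becomes `π k·x / a`. -/
theorem mFourier_eq_planeChar {a : ℝ} (ha : 0 < a) (k : Fin 2 → ℤ) (t : UnitAddTorus (Fin 2)) :
    UnitAddTorus.mFourier k t = planeChar a (k 0, k 1) (torusToPlane a t) := by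
  have h (i : Fin 2) : fourier (k i) (t i) = Complex.exp (2 * π * Complex.I * k i *
      ((AddCircle.equivIoc 1 (-1 / 2 : ℝ) (t i)).1 : ℝ) / (1 : ℝ)) := by
    rw [← fourier_coe_apply, AddCircle.coe_equivIoc]
  have e : UnitAddTorus.mFourier k t = ∏ i, fourier (k i) (t i) := rfl
  rw [e, Fin.prod_univ_two, h, h, ← Complex.exp_add, planeChar]
  congr 1
  have : (a : ℂ) ≠ 0 := by exact_mod_cast ha.ne'
  simp only [torusToPlane, PiLp.smul_apply, smul_eq_mul]
  push_cast
  field_simp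

/-- **Parseval's identity** for square-integrable functions supported in the disk of radius `a`,
expanded in the characters of period `2a`. -/
theorem hasSum_planeChar_parseval {a : ℝ} (ha : 0 < a) {F G : Plane → ℂ} (hF : MemLp F 2)
    (hG : MemLp G 2) (hF0 : ∀ x, x ∉ disk a → F x = 0) (hG0 : ∀ x, x ∉ disk a → G x = 0) :
    HasSum (fun k : ℤ × ℤ => (((4 * a ^ 2)⁻¹ : ℝ) : ℂ) *
      ((∫ x, F x * planeChar a (-k) x) * ∫ x, G x * planeChar a k x)) (∫ x, F x * G x) := by
  -- Parseval on the torus is sesquilinear; applying it to the conjugate of `G` makes it bilinear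
  -- and pairs frequency `-k` of `F` with `k` of `G`.
  have hG' : MemLp (fun x => (starRingEnd ℂ) (G x)) 2 := hG.star
  have mF := memLp_comp_torusToPlane ha hF
  have mG := memLp_comp_torusToPlane ha hG'
  have key := UnitAddTorus.hasSum_prod_mFourierCoeff mG.toLp mF.toLp
  have c1 (k : Fin 2 → ℤ) : UnitAddTorus.mFourierCoeff mF.toLp k =
      ((4 * a ^ 2)⁻¹ : ℝ) * ∫ x, F x * planeChar a (-(k 0, k 1)) x := by
    rw [← integral_comp_torusToPlane ha (f := fun x => F x * planeChar a (-(k 0, k 1)) x)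
      (hF.1.mul (continuous_planeChar _ _).aestronglyMeasurable)
      (fun x hx => by simp [hF0 x hx])]
    refine integral_congr_ae ?_
    filter_upwards [mF.coeFn_toLp] with t ht
    rw [ht, mFourier_eq_planeChar ha, smul_eq_mul, mul_comm]
    rfl
  have c2 (k : Fin 2 → ℤ) : (starRingEnd ℂ) (UnitAddTorus.mFourierCoeff mG.toLp k) =
      ((4 * a ^ 2)⁻¹ : ℝ) * ∫ x, G x * planeChar a (k 0, k 1) x := by
    rw [← integral_comp_torusToPlane ha (f := fun x => G x * planeChar a (k 0, k 1) x)
      (hG.1.mul (continuous_planeChar _ _).aestronglyMeasurable)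
      (fun x hx => by simp [hG0 x hx]), UnitAddTorus.mFourierCoeff, ← integral_conj]
    refine integral_congr_ae ?_
    filter_upwards [mG.coeFn_toLp] with t ht
    rw [ht, UnitAddTorus.mFourier_neg, mFourier_eq_planeChar ha, smul_eq_mul, map_mul,
      Complex.conj_conj, Complex.conj_conj, mul_comm]
  have c3 : ∫ t, (starRingEnd ℂ) (mG.toLp _ t) * mF.toLp _ t =
      ((4 * a ^ 2)⁻¹ : ℝ) * ∫ x, F x * G x := by
    rw [← integral_comp_torusToPlane ha (f := fun x => F x * G x) (hF.1.mul hG.1) (fun x hx => by simp [hF0 x hx])]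
    refine integral_congr_ae ?_
    filter_upwards [mG.coeFn_toLp, mF.coeFn_toLp] with t ht ht'
    rw [ht, ht', Complex.conj_conj, mul_comm]
  simp only [c1, c2, c3] at key
  have h4 : (((4 * a ^ 2)⁻¹ : ℝ) : ℂ) ≠ 0 := by
    exact_mod_cast (by positivity : (4 * a ^ 2)⁻¹ ≠ 0)
  have key2 := (finTwoArrowEquiv ℤ).symm.hasSum_iff.2 (key.mul_left ((((4 * a ^ 2)⁻¹ : ℝ) : ℂ)⁻¹))
  rw [inv_mul_cancel_left₀ h4] at key2
  refine key2.congr_fun ?_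
  rintro ⟨k, l⟩
  simp only [Function.comp_apply, finTwoArrowEquiv_symm_apply, Matrix.cons_val_zero,
    Matrix.cons_val_one]
  field_simp

end Torus

/-! ### The padded convolution and its Fourier transform. -/

theorem measurableSet_disk (R : ℝ) : MeasurableSet (disk R) :=
  Metric.isClosed_closedBall.measurableSet

theorem volume_disk_lt_top (R : ℝ) : volume (disk R) < ⊤ := measure_closedBall_lt_top

section Convolution

variable {b : ℝ} {f f₁ f₂ : Plane → ℂ}

theorem memLp_indicator_disk (hf : MemLp f 2 (volume.restrict (disk b))) :
    MemLp ((disk b).indicator f) 2 :=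
  (memLp_indicator_iff_restrict (measurableSet_disk b)).2 hf

theorem integrableOn_disk_of_memLp (hf : MemLp f 2 (volume.restrict (disk b))) :
    IntegrableOn f (disk b) := by
  have : IsFiniteMeasure (volume.restrict (disk b)) :=
    isFiniteMeasure_restrict.2 (volume_disk_lt_top b).ne
  exact hf.integrable (by norm_num)

theorem integrable_indicator_disk (hf : MemLp f 2 (volume.restrict (disk b))) :
    Integrable ((disk b).indicator f) :=
  (integrable_indicator_iff (measurableSet_disk b)).2 (integrableOn_disk_of_memLp hf)

theorem paddedConv_eq_zero {x : Plane} (hx : x ∉ disk (2 * b)) : paddedConv b f₁ f₂ x = 0 := by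
  have h (y : Plane) : (disk b).indicator f₁ y * (disk b).indicator f₂ (x - y) = 0 := by
    by_cases h1 : y ∈ disk b
    · have h2 : x - y ∉ disk b := by
        simp only [disk, mem_closedBall_zero_iff] at *
        intro h2
        have := norm_add_le (x - y) y
        rw [sub_add_cancel] at this
        linarith
      rw [indicator_of_notMem h2, mul_zero]
    · rw [indicator_of_notMem h1, zero_mul]
  simp [paddedConv, h]

theorem integrable_paddedConv (hf₁ : MemLp f₁ 2 (volume.restrict (disk b)))
    (hf₂ : MemLp f₂ 2 (volume.restrict (disk b))) : Integrable (paddedConv b f₁ f₂) :=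
  (integrable_indicator_disk hf₁).integrable_convolution (ContinuousLinearMap.mul ℂ ℂ)
    (integrable_indicator_disk hf₂)

/-- Pointwise `uv ≤ u² + v²`, together with invariance of the integral under `y ↦ x - y`.
Boundedness and compact support then put the convolution in `L²`, as Parseval requires. -/
theorem norm_paddedConv_le (hf₁ : MemLp f₁ 2 (volume.restrict (disk b)))
    (hf₂ : MemLp f₂ 2 (volume.restrict (disk b))) (x : Plane) :
    ‖paddedConv b f₁ f₂ x‖ ≤ (∫ y, ‖(disk b).indicator f₁ y‖ ^ 2) +
      ∫ y, ‖(disk b).indicator f₂ y‖ ^ 2 := by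
  have h1 := (memLp_indicator_disk hf₁).norm.integrable_sq
  have h2 := (memLp_indicator_disk hf₂).norm.integrable_sq
  rw [← integral_sub_left_eq_self (fun y => ‖(disk b).indicator f₂ y‖ ^ 2) volume x,
    ← integral_add h1 (h2.comp_sub_left x)]
  refine norm_integral_le_of_norm_le (h1.add (h2.comp_sub_left x)) (.of_forall fun y => ?_)
  rw [norm_mul]
  nlinarith [sq_nonneg (‖(disk b).indicator f₁ y‖ - ‖(disk b).indicator f₂ (x - y)‖),
    sq_nonneg (‖(disk b).indicator f₁ y‖), sq_nonneg (‖(disk b).indicator f₂ (x - y)‖)]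

/-- A bounded measurable function supported in a disk is square-integrable. -/
theorem memLp_two_of_bound {R C : ℝ} (hm : AEStronglyMeasurable f) (h0 : ∀ x, x ∉ disk R → f x = 0)
    (hC : ∀ x, ‖f x‖ ≤ C) : MemLp f 2 := by
  have : IsFiniteMeasure (volume.restrict (disk R)) :=
    isFiniteMeasure_restrict.2 (volume_disk_lt_top R).ne
  have h : (disk R).indicator f = f :=
    indicator_eq_self.2 fun x hx => by_contra fun hxd => hx (h0 x hxd)
  rw [← h, memLp_indicator_iff_restrict (measurableSet_disk R)]
  exact MemLp.of_bound hm.restrict C (.of_forall hC)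

theorem memLp_paddedConv (hf₁ : MemLp f₁ 2 (volume.restrict (disk b)))
    (hf₂ : MemLp f₂ 2 (volume.restrict (disk b))) : MemLp (paddedConv b f₁ f₂) 2 :=
  memLp_two_of_bound (integrable_paddedConv hf₁ hf₂).1 (fun _ => paddedConv_eq_zero)
    (norm_paddedConv_le hf₁ hf₂)

/-- A character is multiplicative, so multiplying a convolution by it multiplies each factor by it;
the integral of a convolution is the product of the integrals. -/
theorem integral_paddedConv_mul_planeChar (hf₁ : MemLp f₁ 2 (volume.restrict (disk b)))
    (hf₂ : MemLp f₂ 2 (volume.restrict (disk b))) (a : ℝ) (k : ℤ × ℤ) :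
    ∫ x, paddedConv b f₁ f₂ x * planeChar a k x =
      (∫ x, (disk b).indicator f₁ x * planeChar a k x) *
        ∫ x, (disk b).indicator f₂ x * planeChar a k x := by
  have hI {f : Plane → ℂ} (hf : MemLp f 2 (volume.restrict (disk b))) :
      Integrable fun x => (disk b).indicator f x * planeChar a k x :=
    (integrable_indicator_disk hf).mul_bdd (c := 1)
      (continuous_planeChar a k).aestronglyMeasurable (.of_forall fun x => (norm_planeChar a k x).le)
  have := integral_convolution (ContinuousLinearMap.mul ℂ ℂ) (hI hf₁) (hI hf₂)
  rw [ContinuousLinearMap.mul_apply'] at this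
  rw [← this]
  refine integral_congr_ae (.of_forall fun x => ?_)
  simp only [paddedConv, convolution, ContinuousLinearMap.mul_apply']
  rw [← integral_mul_const]
  refine integral_congr_ae (.of_forall fun y => ?_)
  have := planeChar_add a k y (x - y)
  rw [add_sub_cancel] at this
  simp only [this]
  ring

theorem planeChar_polar (a : ℝ) (k : ℤ × ℤ) (r θ : ℝ) :
    planeChar a k (polar r θ) =
      Complex.exp (((π / a * (k.1 * (r * Real.cos θ) + k.2 * (r * Real.sin θ)) : ℝ) : ℂ) *
        Complex.I) := by
  simp [planeChar, polar]

theorem diskFourier_eq_integral (hb : 0 ≤ b) (hf : MemLp f 2 (volume.restrict (disk b))) (a : ℝ)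
    (k : ℤ × ℤ) : diskFourier f (scaledLattice a k) b =
      ∫ x, (disk b).indicator f x * planeChar a (-k) x := by
  have h1 : IntegrableOn (fun x => f x * planeChar a (-k) x) (disk b) :=
    (integrableOn_disk_of_memLp hf).mul_bdd (c := 1)
      (continuous_planeChar a _).aestronglyMeasurable
      (.of_forall fun x => (norm_planeChar a _ x).le)
  have h2 : (fun x => (disk b).indicator f x * planeChar a (-k) x) =
      (disk b).indicator fun x => f x * planeChar a (-k) x :=
    funext fun _ => (indicator_mul_left (disk b) f (planeChar a (-k))).symm
  rw [h2, integral_indicator (measurableSet_disk b), setIntegral_disk_eq_polar hb h1, diskFourier]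
  refine intervalIntegral.integral_congr fun r _ => intervalIntegral.integral_congr fun θ _ => ?_
  simp only [planeChar_polar, scaledLattice]
  congr 3
  simp
  ring

end Convolution

/-! ### Plane waves in polar coordinates. -/

/-- The complex form of Bessel's integral. -/
theorem integral_exp_neg_eq_besselJ (m : ℤ) (x : ℝ) :
    ∫ t in (0 : ℝ)..(2 * π), Complex.exp (((-(m * t - x * Real.sin t) : ℝ) : ℂ) * Complex.I) =
      2 * π * besselJ m x := by
  -- The imaginary part vanishes because it is odd under `t ↦ 2π - t`.
  have hs : ∫ t in (0 : ℝ)..(2 * π), Real.sin (m * t - x * Real.sin t) = 0 := by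
    have h := intervalIntegral.integral_comp_sub_left (a := 0) (b := 2 * π)
      (fun t => Real.sin (m * t - x * Real.sin t)) (2 * π)
    rw [sub_self, sub_zero] at h
    have h2 : ∫ t in (0 : ℝ)..(2 * π), Real.sin (m * (2 * π - t) - x * Real.sin (2 * π - t)) =
        ∫ t in (0 : ℝ)..(2 * π), -Real.sin (m * t - x * Real.sin t) := by
      refine intervalIntegral.integral_congr fun t _ => ?_
      simp only [Real.sin_two_pi_sub]
      rw [← Real.sin_neg (m * t - x * Real.sin t), ← Real.sin_add_int_mul_two_pi (-(m * t - x * Real.sin t)) m]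
      congr 1
      ring
    rw [h2, intervalIntegral.integral_neg] at h
    linarith
  have e (t : ℝ) : Complex.exp (((-(m * t - x * Real.sin t) : ℝ) : ℂ) * Complex.I) =
      ((Real.cos (m * t - x * Real.sin t) : ℝ) : ℂ) -
        ((Real.sin (m * t - x * Real.sin t) : ℝ) : ℂ) * Complex.I := by
    rw [Complex.exp_mul_I, ← Complex.ofReal_cos, ← Complex.ofReal_sin, Real.cos_neg, Real.sin_neg]
    push_cast
    ring
  simp only [e]
  rw [intervalIntegral.integral_sub (Continuous.intervalIntegrable (by fun_prop) _ _)
    (Continuous.intervalIntegrable (by fun_prop) _ _), intervalIntegral.integral_mul_const,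
    intervalIntegral.integral_ofReal, intervalIntegral.integral_ofReal, hs, besselJ]
  have := Real.pi_ne_zero
  push_cast
  field_simp
  simp

/-- The angular integral of a plane wave against `e^{-i m θ}`. -/
theorem integral_planeWave_angular (m : ℤ) (x φ : ℝ) :
    ∫ θ in (0 : ℝ)..(2 * π), Complex.exp (((x * Real.cos (θ - φ) - m * θ : ℝ) : ℂ) * Complex.I) =
      2 * π * (Complex.I ^ m * Complex.exp (-(Complex.I * m * φ)) * besselJ m x) := by
  have hp : Function.Periodic
      (fun θ : ℝ => Complex.exp (((x * Real.cos (θ - φ) - m * θ : ℝ) : ℂ) * Complex.I)) (2 * π) := by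
    intro θ
    have h1 : Real.cos (θ + 2 * π - φ) = Real.cos (θ - φ) := by
      rw [add_sub_right_comm, Real.cos_add_two_pi]
    simp only [h1]
    rw [Complex.exp_eq_exp_iff_exists_int]
    refine ⟨-m, ?_⟩
    push_cast
    ring
  -- Substituting `θ = t + φ - π/2` turns `cos (θ - φ)` into `sin t`, and the shift contributes `i^m
  -- e^{-imφ}`.
  have h1 := hp.intervalIntegral_add_eq (φ - π / 2) 0
  have h2 := intervalIntegral.integral_comp_add_right (a := 0) (b := 2 * π)
    (fun θ : ℝ => Complex.exp (((x * Real.cos (θ - φ) - m * θ : ℝ) : ℂ) * Complex.I)) (φ - π / 2)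
  rw [zero_add, add_comm (2 * π) (φ - π / 2), h1, zero_add] at h2
  have hI : Complex.I ^ m = Complex.exp (m * (π / 2 * Complex.I)) := by
    rw [Complex.exp_int_mul, Complex.exp_pi_div_two_mul_I]
  rw [← h2, mul_left_comm, ← integral_exp_neg_eq_besselJ, ← intervalIntegral.integral_const_mul, hI,
    ← Complex.exp_add]
  refine intervalIntegral.integral_congr fun t _ => ?_
  have h3 : Real.cos (t + (φ - π / 2) - φ) = Real.sin t := by
    rw [← Real.cos_sub_pi_div_two]; congr 1; ring
  simp only [h3]
  rw [← Complex.exp_add]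
  congr 1
  push_cast
  ring

theorem latticeNorm_mul_cos_sin (k : ℤ × ℤ) :
    latticeNorm k * Real.cos (latticeAngle k) = k.1 ∧
      latticeNorm k * Real.sin (latticeAngle k) = k.2 := by
  set w : ℂ := ⟨(k.1 : ℝ), (k.2 : ℝ)⟩ with hw
  have hn : latticeNorm k = ‖w‖ := by
    rw [Complex.norm_def, Complex.normSq_apply, latticeNorm, ← pow_two, ← pow_two]
  have ha : latticeAngle k = w.arg - toIcoDiv Real.two_pi_pos 0 w.arg * (2 * π) := by
    rw [latticeAngle, toIcoMod, zsmul_eq_mul]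
  rw [ha, hn, Real.cos_sub_int_mul_two_pi, Real.sin_sub_int_mul_two_pi, Complex.norm_mul_cos_arg,
    Complex.norm_mul_sin_arg]
  exact ⟨rfl, rfl⟩

theorem planeChar_polar_eq (a : ℝ) (k : ℤ × ℤ) (r θ : ℝ) :
    planeChar a k (polar r θ) =
      Complex.exp (((π * latticeNorm k / a * r * Real.cos (θ - latticeAngle k) : ℝ) : ℂ) *
        Complex.I) := by
  obtain ⟨h1, h2⟩ := latticeNorm_mul_cos_sin k
  rw [planeChar_polar, Real.cos_sub, ← h1, ← h2]
  congr 3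
  ring

/-! ### Basis functions and their Fourier coefficients. -/

/-- The conjugate of `Ψ_{nm}^a`, as a function on the plane supported in the disk. -/
noncomputable def conjBasis (a : ℝ) (n : ℕ) (m : ℤ) : Plane → ℂ :=
  (disk a).indicator fun x => (radial a n m ‖x‖ : ℂ) * (((√(2 * π))⁻¹ : ℝ) : ℂ) *
    (starRingEnd ℂ) ((((x 0 : ℝ) + (x 1 : ℝ) * Complex.I) / ‖x‖) ^ m)

/-- The power of `(x₀ + i x₁) / ‖x‖` encodes the angular phase without choosing a branch of the
angle. At the origin this quotient is `0 / 0 = 0`, hence the restriction to `r > 0`. -/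
theorem conjBasis_polar {a r : ℝ} (n : ℕ) (m : ℤ) (hr : 0 < r) (hra : r ≤ a) (θ : ℝ) :
    conjBasis a n m (polar r θ) = (starRingEnd ℂ) (basisFun a n m r θ) := by
  rw [conjBasis, indicator_of_mem ((polar_mem_disk hr.le).2 hra), norm_polar, abs_of_pos hr,
    basisFun, angular, map_mul, map_mul, Complex.conj_ofReal, Complex.conj_ofReal, mul_assoc]
  congr 3
  have hr' : (r : ℂ) ≠ 0 := by exact_mod_cast hr.ne'
  have h1 : (((polar r θ) 0 : ℝ) : ℂ) + ((polar r θ) 1 : ℝ) * Complex.I =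
      r * Complex.exp (θ * Complex.I) := by
    rw [Complex.exp_mul_I]
    simp [polar]
    ring
  rw [h1, mul_div_cancel_left₀ _ hr', ← Complex.exp_int_mul]
  congr 1
  ring

theorem conjBasis_eq_zero {a : ℝ} {n : ℕ} {m : ℤ} (x : Plane) (hx : x ∉ disk a) :
    conjBasis a n m x = 0 := indicator_of_notMem hx _

theorem continuous_radial (a : ℝ) (n : ℕ) (m : ℤ) : Continuous (radial a n m) := by
  have := continuous_besselJ m
  unfold radial
  fun_prop

theorem memLp_conjBasis (a : ℝ) (n : ℕ) (m : ℤ) : MemLp (conjBasis a n m) 2 := by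
  obtain ⟨C, hC⟩ := (isCompact_Icc (a := (0 : ℝ)) (b := a)).exists_bound_of_continuousOn
    (continuous_radial a n m).continuousOn
  refine memLp_two_of_bound (R := a) (C := |C| * (√(2 * π))⁻¹) ?_ conjBasis_eq_zero fun x => ?_
  · refine (Measurable.aestronglyMeasurable ?_).indicator (measurableSet_disk a)
    have := (continuous_radial a n m).measurable
    have h2 : Measurable fun x : Plane => ((((x 0 : ℝ) + (x 1 : ℝ) * Complex.I) / ‖x‖ : ℂ)) := by
      fun_prop
    have h3 : Measurable fun x : Plane => ((((x 0 : ℝ) + (x 1 : ℝ) * Complex.I) / ‖x‖ : ℂ)) ^ m :=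
      h2.pow_const m
    have h4 := (Complex.continuous_conj.measurable).comp h3
    exact ((Complex.measurable_ofReal.comp (this.comp measurable_norm)).mul_const _).mul h4
  · by_cases hx : x ∈ disk a
    · rw [conjBasis, indicator_of_mem hx, norm_mul, norm_mul, RCLike.norm_conj, norm_zpow, norm_div]
      have h0 : ‖((x 0 : ℝ) : ℂ) + (x 1 : ℝ) * Complex.I‖ = ‖x‖ := by
        rw [Complex.norm_add_mul_I, EuclideanSpace.norm_eq, Fin.sum_univ_two]
        simp
      have h1 : ‖((‖x‖ : ℝ) : ℂ)‖ = ‖x‖ := by simp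
      rw [h0, h1]
      have h2 : (‖x‖ / ‖x‖) ^ m ≤ 1 := by
        rcases eq_or_ne ‖x‖ 0 with h | h
        · rw [h, div_zero]
          rcases eq_or_ne m 0 with rfl | hm
          · simp
          · rw [zero_zpow _ hm]; exact zero_le_one
        · rw [div_self h, one_zpow]
      have h3 : ‖((radial a n m ‖x‖ : ℝ) : ℂ)‖ ≤ |C| := by
        rw [Complex.norm_real]
        exact (hC _ ⟨norm_nonneg x, mem_closedBall_zero_iff.1 hx⟩).trans (le_abs_self C)
      have h4 : ‖(((√(2 * π))⁻¹ : ℝ) : ℂ)‖ = (√(2 * π))⁻¹ := by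
        rw [Complex.norm_real, Real.norm_eq_abs, abs_of_nonneg (by positivity)]
      rw [h4]
      calc _ ≤ |C| * (√(2 * π))⁻¹ * 1 := by gcongr
        _ = _ := mul_one _
    · rw [conjBasis_eq_zero x hx, norm_zero]
      positivity

theorem coeff_eq_integral {a : ℝ} (ha : 0 ≤ a) (n : ℕ) (m : ℤ) {F : Plane → ℂ} (hF : MemLp F 2)
    (hF0 : ∀ x, x ∉ disk a → F x = 0) :
    coeff a n m F = ∫ x, F x * conjBasis a n m x := by
  have hI : Integrable fun x => F x * conjBasis a n m x := hF.integrable_mul (memLp_conjBasis a n m)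
  rw [← setIntegral_eq_integral_of_forall_compl_eq_zero (s := disk a)
    (fun x hx => by rw [hF0 x hx, zero_mul]), setIntegral_disk_eq_polar ha hI.integrableOn, coeff]
  rw [intervalIntegral.integral_of_le ha, intervalIntegral.integral_of_le ha]
  refine setIntegral_congr_fun measurableSet_Ioc fun r hr =>
    intervalIntegral.integral_congr fun θ _ => ?_
  simp only [conjBasis_polar n m hr.1 hr.2]

/-- Solve the definition of `N` for `|J_m(z)|`; positivity of `N` rests on `z² > m²`. This
eliminates `|J_m(z)| / √N` from the Fourier coefficients. -/
theorem abs_besselJ_besselZero (a : ℝ) (ha : 0 < a) (n : ℕ) (m : ℤ) :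
    0 < normConst a (n + 1) m ∧ |besselJ m (besselZero m (n + 1))| =
      √2 * rhoRatio a (n + 1) m * √(normConst a (n + 1) m) := by
  have hz := besselZero_mem m n
  set z := besselZero m (n + 1) with hzdef
  have hJ := besselJ_ne_zero_of_mem_derivZeros hz
  have hJ2 : 0 < besselJ m z ^ 2 := by positivity
  have h2 : √2 ^ 2 = 2 := Real.sq_sqrt (by norm_num)
  rw [normConst, ← hzdef, rhoRatio]
  rcases eq_or_ne m 0 with rfl | hm
  · have hN : 0 < a ^ 2 / 2 * (1 - ((0 : ℤ) : ℝ) ^ 2 / z ^ 2) * besselJ 0 z ^ 2 := by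
      simp only [Int.cast_zero, ne_eq, OfNat.ofNat_ne_zero, not_false_eq_true, zero_pow, zero_div,
        sub_zero, mul_one]
      positivity
    refine ⟨hN, ?_⟩
    rw [if_pos rfl, ← sq_eq_sq₀ (abs_nonneg _) (by positivity), sq_abs, mul_pow, mul_pow, h2,
      Real.sq_sqrt hN.le]
    simp only [Int.cast_zero, ne_eq, OfNat.ofNat_ne_zero, not_false_eq_true, zero_pow, zero_div,
      sub_zero, mul_one]
    field_simp
  · have hz0 : 0 < z := hz.2.resolve_right fun h => hm h.1
    have hd : 0 < z ^ 2 - (m : ℝ) ^ 2 := sub_pos.2 (sq_lt_sq_of_critical hz0 hz.1)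
    have e : a ^ 2 / 2 * (1 - (m : ℝ) ^ 2 / z ^ 2) * besselJ m z ^ 2 =
        a ^ 2 / 2 * ((z ^ 2 - (m : ℝ) ^ 2) / z ^ 2) * besselJ m z ^ 2 := by
      field_simp
    have hN : 0 < a ^ 2 / 2 * (1 - (m : ℝ) ^ 2 / z ^ 2) * besselJ m z ^ 2 := by
      rw [e]; positivity
    refine ⟨hN, ?_⟩
    rw [if_neg hm, rho, ← hzdef, ← sq_eq_sq₀ (abs_nonneg _) (by positivity), sq_abs, mul_pow,
      mul_pow, div_pow, h2, Real.sq_sqrt hN.le, Real.sq_sqrt hd.le, e]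
    field_simp

/-- The Fourier coefficients of the basis function, up to the factor `4 a²`. -/
theorem integral_conjBasis_mul_planeChar {a : ℝ} (ha : 0 < a) (n : ℕ) (m : ℤ) (k : ℤ × ℤ) :
    ∫ x, conjBasis a (n + 1) m x * planeChar a k x = (4 * a ^ 2 : ℝ) * cPrime a k (n + 1) m := by
  have hI : IntegrableOn (fun x => conjBasis a (n + 1) m x * planeChar a k x) (disk a) := by
    have : IsFiniteMeasure (volume.restrict (disk a)) :=
      isFiniteMeasure_restrict.2 (volume_disk_lt_top a).ne
    exact (((memLp_conjBasis a (n + 1) m).restrict (disk a)).integrable (by norm_num)).mul_bdd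
      (c := 1) (continuous_planeChar a _).aestronglyMeasurable
      (.of_forall fun x => (norm_planeChar a _ x).le)
  rw [← setIntegral_eq_integral_of_forall_compl_eq_zero (s := disk a)
    (fun x hx => by rw [conjBasis_eq_zero x hx, zero_mul]), setIntegral_disk_eq_polar ha.le hI]
  set t := π * latticeNorm k with ht
  have ht0 : 0 ≤ t := mul_nonneg Real.pi_pos.le (Real.sqrt_nonneg _)
  set w : ℂ := Complex.I ^ m * Complex.exp (-(Complex.I * m * latticeAngle k)) with hw
  set A : ℝ := (√(normConst a (n + 1) m))⁻¹ * (√(2 * π))⁻¹ * (2 * π) with hA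
  have inner (r : ℝ) (hr : r ∈ Ioc 0 a) :
      ∫ θ in (0 : ℝ)..(2 * π), conjBasis a (n + 1) m (polar r θ) * planeChar a k (polar r θ) * r =
        ((besselJ m (rho a (n + 1) m * r) * besselJ m (t / a * r) * r : ℝ) : ℂ) * (A * w) := by
    have e (θ : ℝ) : conjBasis a (n + 1) m (polar r θ) * planeChar a k (polar r θ) * r =
        ((radial a (n + 1) m r * (√(2 * π))⁻¹ * r : ℝ) : ℂ) *
          Complex.exp (((t / a * r * Real.cos (θ - latticeAngle k) - m * θ : ℝ) : ℂ) *
            Complex.I) := by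
      rw [conjBasis_polar _ _ hr.1 hr.2, planeChar_polar_eq, basisFun, angular, map_mul, map_mul,
        Complex.conj_ofReal, Complex.conj_ofReal, ← Complex.exp_conj, ← ht]
      have e2 : ((t / a * r * Real.cos (θ - latticeAngle k) - m * θ : ℝ) : ℂ) * Complex.I =
          (starRingEnd ℂ) (Complex.I * m * θ) +
            ((t / a * r * Real.cos (θ - latticeAngle k) : ℝ) : ℂ) * Complex.I := by
        simp
        ring
      rw [e2, Complex.exp_add]
      push_cast
      ring
    simp only [e]
    rw [intervalIntegral.integral_const_mul, integral_planeWave_angular, hA, hw, radial]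
    push_cast
    ring
  rw [intervalIntegral.integral_of_le ha.le, setIntegral_congr_fun measurableSet_Ioc inner,
    ← intervalIntegral.integral_of_le ha.le, intervalIntegral.integral_mul_const,
    intervalIntegral.integral_ofReal, integral_besselJ_besselZero m n ha t ht0]
  obtain ⟨hN, habs⟩ := abs_besselJ_besselZero a ha n m
  -- Here `J_m(z) / √N = ε √2 · rhoRatio`, and `√2 · 2π / √(2π) = 2√π = 4 · √π / 2`.
  have key : a ^ 2 * besselJ m (besselZero m (n + 1)) * besselQuot (n + 1) m t * A =
      4 * a ^ 2 * (√π / 2 * signFactor (n + 1) m * rhoRatio a (n + 1) m *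
        besselQuot (n + 1) m t) := by
    have hsN : 0 < √(normConst a (n + 1) m) := Real.sqrt_pos.2 hN
    have hsp : 0 < √π := Real.sqrt_pos.2 Real.pi_pos
    have hp : √π ^ 2 = π := Real.sq_sqrt Real.pi_pos.le
    have h2 : √2 ^ 2 = 2 := Real.sq_sqrt (by norm_num)
    rw [signFactor_mul_abs_besselJ, habs, hA, Real.sqrt_mul (by norm_num : (0 : ℝ) ≤ 2)]
    field_simp
    rw [hp]
    ring
  rw [cPrime, ← ht, ← mul_assoc, ← Complex.ofReal_mul, key, hw]
  push_cast
  ring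

end DiskConvolution

theorem mainTheorem6 (a : ℝ) (ha : 0 < a)
    (f₁ f₂ : DiskConvolution.Plane → ℂ)
    (hf₁ : MeasureTheory.MemLp f₁ 2
      (MeasureTheory.volume.restrict (DiskConvolution.disk (a / 2))))
    (hf₂ : MeasureTheory.MemLp f₂ 2
      (MeasureTheory.volume.restrict (DiskConvolution.disk (a / 2))))
    (m : ℤ) (n : ℕ) (hn : 1 ≤ n) :
    HasSum
      (fun k : ℤ × ℤ =>
        DiskConvolution.cPrime a k n m *
          DiskConvolution.diskFourier f₁ (DiskConvolution.scaledLattice a k) (a / 2) *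
          DiskConvolution.diskFourier f₂ (DiskConvolution.scaledLattice a k) (a / 2))
      (DiskConvolution.coeff a n m (DiskConvolution.paddedConv (a / 2) f₁ f₂)) := by
  open DiskConvolution in
  obtain ⟨n, rfl⟩ := Nat.exists_eq_add_of_le' hn
  have h0 (x : Plane) (hx : x ∉ disk a) : paddedConv (a / 2) f₁ f₂ x = 0 :=
    paddedConv_eq_zero (by rwa [mul_div_cancel₀ a two_ne_zero])
  have hF := memLp_paddedConv hf₁ hf₂
  rw [coeff_eq_integral ha.le (n + 1) m hF h0]
  -- The coefficient of the convolution is taken at `-k`, which matches the minus sign in the disk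
  -- transform; the `4a²` in the coefficient of the basis function cancels the Parseval factor.
  refine (hasSum_planeChar_parseval ha hF (memLp_conjBasis a (n + 1) m) h0
    conjBasis_eq_zero).congr_fun fun k => ?_
  rw [integral_paddedConv_mul_planeChar hf₁ hf₂, integral_conjBasis_mul_planeChar ha,
    diskFourier_eq_integral (by positivity) hf₁, diskFourier_eq_integral (by positivity) hf₂]
  have : (a : ℂ) ≠ 0 := by exact_mod_cast ha.ne'
  push_cast
  field_simp
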